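/- **Theorem 2.** Let $n\ge 2$. For $m\ge 1$ let $\pi: X_m\to\mathbf P^{n-1}$ be the total space of the holomorphic line bundle that has fibre coordinates $y_i$ over $U_i=\{z_i\ne0\}$ and transition functions $y_i=(z_i/z_j)^m y_j$; for $m=n$ this is the canonical line bundle of $\mathbf P^{n-1}$. The complement of the zero section is parametrized by the $m$-to-one map $\mathbf C^n\setminus\{0\}\to X_m$ that sends $z$ to the point over $[z]$ with $y_i=z_i^m$, and $U(n)$ acts on $X_m$ through its linear action on $\mathbf C^n$. Write $t=\log|z|^2$. A steady gradient Kähler–Ricci soliton on $X_m$ is a Kähler metric $g$ with a smooth function $f:X_m\to\mathbf R$ such that $R_{i\bar j}=f_{,i\bar j}$ and $f_{,ij}=0$. (1) For every $a>0$ there is a complete, $U(n)$-invariant, steady gradient Kähler–Ricci soliton $(g,f)$ on $X_n$. On $\mathbf C^n\setminus\{0\}$ it is given by $g_{i\bar j}=\partial_i\partial_{\bar j}u(t)$ and $f=\varphi(t)$, where $u\in C^\infty(\mathbf R)$, $\varphi=u'>0$, $\varphi'>0$, $\varphi^{n-1}\varphi' e^{\varphi}=e^{nt}$ on $\mathbf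 R$, and $\varphi(t)\to a$ as $t\to-\infty$. The metric that $g$ induces on each fibre of $\pi$ has positive Gaussian curvature. (2) Conversely, let $m\ge1$, let $u\in C^\infty(\mathbf R)$, and suppose that $\partial_i\partial_{\bar j}u(t)$ on $\mathbf C^n\setminus\{0\}$ is the pull-back of a Kähler metric on all of $X_m$ which is a steady gradient Kähler–Ricci soliton with a $U(n)$-invariant function $f$. Then $m=n$, and $\varphi=u'$ satisfies $\varphi^{n-1}\varphi'e^{\alpha\varphi}=\beta e^{nt}$ on $\mathbf R$ for some constants $\alpha\in\mathbf R$ and $\beta>0$, and $\varphi(t)\to a$ as $t\to-\infty$ for some $a>0$. -/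

import Mathlib

open Topology
open scoped Manifold ContDiff ComplexOrder

noncomputable section

namespace LineBundleSoliton

/-! ### The total space of the line bundle and its charts -/

/-- Pairs `(z, y)` with `z ∈ ℂⁿ ∖ {0}` and `y ∈ ℂ`. -/
abbrev PreTotal (n : ℕ) : Type := {q : (Fin n → ℂ) × ℂ // q.1 ≠ 0}

/-- `(z, y) ∼ (c z, c⁻ᵐ y)` for `c ∈ ℂ ∖ {0}`. -/
def totalSetoid (n m : ℕ) : Setoid (PreTotal n) where
  r q q' := ∃ c : ℂ, c ≠ 0 ∧ q'.1.1 = c • q.1.1 ∧ q.1.2 = c ^ m * q'.1.2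
  iseqv :=
    { refl := fun q => ⟨1, one_ne_zero, by simp, by simp⟩
      symm := by
        rintro q q' ⟨c, hc, h1, h2⟩
        refine ⟨c⁻¹, inv_ne_zero hc, ?_, ?_⟩
        · rw [h1, smul_smul, inv_mul_cancel₀ hc, one_smul]
        · rw [h2, ← mul_assoc, ← mul_pow, inv_mul_cancel₀ hc, one_pow, one_mul]
      trans := by
        rintro q q' q'' ⟨c, hc, h1, h2⟩ ⟨d, hd, h3, h4⟩
        refine ⟨d * c, mul_ne_zero hd hc, ?_, ?_⟩
        · rw [h3, h1, smul_smul]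
        · rw [h2, h4]; ring }

/-- The total space `X_m` of the holomorphic line bundle over `ℙⁿ⁻¹` with fibre coordinates `y_i`
over `U_i = {z_i ≠ 0}` and transition functions `y_i = (z_i / z_j) ^ m * y_j`. The class of `(z, y)`
is the point over `[z]` with `y_i = z_i ^ m * y`. For `m = n` these are, up to signs that are
absorbed in the `y_i`, the transition functions of the canonical bundle: the `(n-1)`-forms
`d(z_1/z_i) ∧ ⋯` over `U_i` and `U_j` differ by the factor `± (z_j / z_i) ^ n`. -/
def X (n m : ℕ) : Type := Quotient (totalSetoid n m)

instance (n m : ℕ) : TopologicalSpace (X n m) :=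
  inferInstanceAs (TopologicalSpace (Quotient (totalSetoid n m)))

variable {n m : ℕ}

/-- The class of `(z, y)`. -/
def mk (m : ℕ) (q : PreTotal n) : X n m := Quotient.mk (totalSetoid n m) q

/-- The part of `X_m` over `U_j`. -/
def domain (j : Fin n) : Set (X n m) :=
  {x | Quotient.lift (s := totalSetoid n m) (fun q => q.1.1 j ≠ 0) (by
    rintro q q' ⟨c, hc, h1, -⟩
    simp [h1, hc]) x}

/-- The coordinates over `U_j`: the fibre coordinate `y_j` in slot `j`, the inhomogeneous
coordinates `z_k / z_j` in the other slots. -/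
def coord (j : Fin n) : X n m → (Fin n → ℂ) :=
  Quotient.lift (s := totalSetoid n m)
    (fun q k => if k = j then q.1.1 j ^ m * q.1.2 else q.1.1 k / q.1.1 j) (by
    rintro q q' ⟨c, hc, h1, h2⟩
    funext k
    split_ifs with h
    · rw [h1, h2, Pi.smul_apply, smul_eq_mul]; ring
    · rw [h1, Pi.smul_apply, Pi.smul_apply, smul_eq_mul, smul_eq_mul,
        mul_div_mul_left _ _ hc])

theorem update_one_ne_zero (j : Fin n) (p : Fin n → ℂ) : Function.update p j 1 ≠ 0 := by
  intro h
  have := congrFun h j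
  simp at this

/-- The inverse of the coordinates over `U_j`. -/
def param (j : Fin n) (p : Fin n → ℂ) : X n m :=
  mk m ⟨(Function.update p j 1, p j), update_one_ne_zero j p⟩

theorem continuous_mk : Continuous (mk m : PreTotal n → X n m) := continuous_quotient_mk'

theorem isQuotientMap_mk : IsQuotientMap (mk m : PreTotal n → X n m) := isQuotientMap_quotient_mk'

theorem isOpen_domain (j : Fin n) : IsOpen (domain j : Set (X n m)) := by
  rw [← isQuotientMap_mk.isOpen_preimage]
  have : Continuous fun q : PreTotal n => q.1.1 j := by fun_prop
  exact this.isOpen_preimage _ isOpen_ne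

/-- The chart over `U_j`. -/
def chart (j : Fin n) : OpenPartialHomeomorph (X n m) (Fin n → ℂ) where
  toFun := coord j
  invFun := param j
  source := domain j
  target := Set.univ
  map_source' := fun _ _ => Set.mem_univ _
  map_target' := fun p _ => by
    change Function.update p j 1 j ≠ 0
    simp
  left_inv' := by
    intro x
    induction x using Quotient.inductionOn with
    | h q =>
      intro (hq : q.1.1 j ≠ 0)
      refine Quotient.sound (s := totalSetoid n m) ⟨q.1.1 j, hq, ?_, ?_⟩
      · funext k
        by_cases h : k = j
        · subst h; simp
        · simp [h, coord, mul_div_cancel₀ _ hq]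
      · simp [coord]
  right_inv' := by
    intro p _
    funext k
    by_cases h : k = j
    · subst h; simp [coord, param, mk]
    · simp [coord, param, mk, h]
  open_source := isOpen_domain j
  open_target := isOpen_univ
  continuousOn_toFun := by
    rw [isQuotientMap_mk.continuousOn_isOpen_iff (isOpen_domain j)]
    change ContinuousOn
      (fun (q : PreTotal n) k => if k = j then q.1.1 j ^ m * q.1.2 else q.1.1 k / q.1.1 j)
      {q | q.1.1 j ≠ 0}
    refine continuousOn_pi.2 fun k => ?_
    by_cases h : k = j
    · simp only [h, if_true]
      fun_prop
    · simp only [h, if_false]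
      exact ContinuousOn.div (by fun_prop) (by fun_prop) fun q hq => hq
  continuousOn_invFun := by
    refine Continuous.continuousOn ?_
    refine continuous_mk.comp (Continuous.subtype_mk ?_ _)
    fun_prop

theorem exists_mem_domain (x : X n m) : ∃ j : Fin n, x ∈ domain j := by
  induction x using Quotient.inductionOn with
  | h q => exact Function.ne_iff.1 q.2

instance : ChartedSpace (Fin n → ℂ) (X n m) where
  atlas := Set.range chart
  chartAt x := chart (exists_mem_domain x).choose
  mem_chart_source x := (exists_mem_domain x).choose_spec
  chart_mem_atlas _ := ⟨_, rfl⟩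

/-- `X_m` is a complex manifold. -/
instance : IsManifold 𝓘(ℂ, Fin n → ℂ) ω (X n m) := by
  refine isManifold_of_contDiffOn _ _ _ ?_
  rintro _ _ ⟨i, rfl⟩ ⟨j, rfl⟩
  have hsrc : ∀ p : Fin n → ℂ, p ∈ ((chart i : OpenPartialHomeomorph (X n m) _).symm.trans
      (chart j)).source → Function.update p i (1 : ℂ) j ≠ 0 := fun p hp => hp.2
  simp only [modelWithCornersSelf_coe, modelWithCornersSelf_coe_symm, Function.comp_id,
    Function.id_comp, Set.range_id, Set.inter_univ, Set.preimage_id]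
  change ContDiffOn ℂ ω (fun (p : Fin n → ℂ) k =>
    if k = j then Function.update p i 1 j ^ m * p i
      else Function.update p i 1 k / Function.update p i 1 j) _
  have hup : ∀ k : Fin n, ContDiff ℂ ω fun p : Fin n → ℂ => Function.update p i 1 k := by
    intro k
    by_cases h : k = i
    · subst h; simpa using contDiff_const
    · simpa [h] using contDiff_apply ℂ ℂ k
  refine contDiffOn_pi.2 fun k => ?_
  by_cases h : k = j
  · simp only [h, if_true]
    exact (((hup j).pow m).mul (contDiff_apply ℂ ℂ i)).contDiffOn
  · simp only [h, if_false]
    exact (hup k).contDiffOn.div (hup j).contDiffOn hsrc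

/-- The `m`-to-one parametrization of the complement of the zero section by `ℂⁿ ∖ {0}`. -/
def cover (m : ℕ) (z : Fin n → ℂ) (hz : z ≠ 0) : X n m := mk m ⟨(z, 1), hz⟩

/-- The same parametrization in the coordinates over `U_j`. -/
def coverCoord (m : ℕ) (j : Fin n) (z : Fin n → ℂ) : Fin n → ℂ :=
  fun k => if k = j then z j ^ m else z k / z j

theorem coord_cover (j : Fin n) (z : Fin n → ℂ) (hz : z ≠ 0) :
    coord j (cover m z hz) = coverCoord m j z := by
  funext k
  simp [coord, cover, coverCoord, mk]

/-- The action of `U(n)` on `X_m`, induced by its linear action on `ℂⁿ`. -/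
def rotate (A : Matrix.unitaryGroup (Fin n) ℂ) : X n m → X n m :=
  Quotient.map (sa := totalSetoid n m) (sb := totalSetoid n m)
    (fun q => ⟨(A.1.mulVec q.1.1, q.1.2), by
      intro h
      have h' : A.1.mulVec q.1.1 = 0 := h
      have h2 : (star A.1 * A.1).mulVec q.1.1 = 0 := by
        rw [← Matrix.mulVec_mulVec, h', Matrix.mulVec_zero]
      rw [Matrix.UnitaryGroup.star_mul_self, Matrix.one_mulVec] at h2
      exact q.2 h2⟩) (by
    rintro q q' ⟨c, hc, h1, h2⟩
    exact ⟨c, hc, by simp [h1, Matrix.mulVec_smul], h2⟩)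

/-! ### Calculus on `ℂⁿ` -/

/-- `∂F/∂z_k`. -/
def dz (k : Fin n) (F : (Fin n → ℂ) → ℂ) (p : Fin n → ℂ) : ℂ :=
  (fderiv ℝ F p (Pi.single k 1) - Complex.I * fderiv ℝ F p (Pi.single k Complex.I)) / 2

/-- `∂F/∂z̄_k`. -/
def dzbar (k : Fin n) (F : (Fin n → ℂ) → ℂ) (p : Fin n → ℂ) : ℂ :=
  (fderiv ℝ F p (Pi.single k 1) + Complex.I * fderiv ℝ F p (Pi.single k Complex.I)) / 2

/-- The holomorphic Jacobian matrix `∂τ_k/∂z_a` of a holomorphic map. -/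
def jac (τ : (Fin n → ℂ) → (Fin n → ℂ)) (p : Fin n → ℂ) : Matrix (Fin n) (Fin n) ℂ :=
  Matrix.of fun k a => fderiv ℂ τ p (Pi.single a 1) k

/-- The value at `p` of the pull-back under the holomorphic map `τ` of the Hermitian form with
components `h k l = h_{k l̄}`. -/
def pullback (τ : (Fin n → ℂ) → (Fin n → ℂ)) (h : (Fin n → ℂ) → Matrix (Fin n) (Fin n) ℂ)
    (p : Fin n → ℂ) : Matrix (Fin n) (Fin n) ℂ :=
  (jac τ p).transpose * h (τ p) * (jac τ p).map star

/-- The Ricci tensor `R_{a b̄} = - ∂_a ∂_b̄ log det h`. -/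
def ricci (h : (Fin n → ℂ) → Matrix (Fin n) (Fin n) ℂ) (a b : Fin n) (p : Fin n → ℂ) : ℂ :=
  - dz a (dzbar b fun q => ((Real.log (h q).det.re : ℝ) : ℂ)) p

/-- The Christoffel symbols `Γ^k_{a b} = ∑_l h^{k l̄} ∂_a h_{b l̄}`, where
`∑_l h_{b l̄} h^{k l̄} = δ_b^k`. -/
def christoffel (h : (Fin n → ℂ) → Matrix (Fin n) (Fin n) ℂ) (k a b : Fin n) (p : Fin n → ℂ) : ℂ :=
  ∑ l, dz a (fun q => h q b l) p * (h p)⁻¹ l k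

/-- The covariant second derivative `F_{,a b}`. -/
def hess (h : (Fin n → ℂ) → Matrix (Fin n) (Fin n) ℂ) (F : (Fin n → ℂ) → ℂ) (a b : Fin n)
    (p : Fin n → ℂ) : ℂ :=
  dz a (dz b F) p - ∑ k, christoffel h k a b p * dz k F p

/-- The length of the curve `c` on `[0, 1]`. -/
def curveLength (h : (Fin n → ℂ) → Matrix (Fin n) (Fin n) ℂ) (c : ℝ → (Fin n → ℂ)) : ℝ :=
  ∫ t in (0 : ℝ)..1, √ (∑ a, ∑ b, h (c t) a b * deriv c t a * star (deriv c t b)).re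

/-- The function `|z|²` on `ℂⁿ`. -/
def normSq (z : Fin n → ℂ) : ℝ := ∑ i, ‖z i‖ ^ 2

/-- The components `∂_a ∂_b̄ u(log |z|²)`, at points of `ℂⁿ ∖ {0}`. -/
def radialForm (u : ℝ → ℝ) (z : Fin n → ℂ) : Matrix (Fin n) (Fin n) ℂ :=
  Matrix.of fun a b => dz a (dzbar b fun w => ((u (Real.log (normSq w)) : ℝ) : ℂ)) z

/-! ### Kähler metrics on `X_m` -/

/-- A smooth Kähler metric on `X_m`, given by its components `g_{a b̄}` in the charts. -/
structure KahlerMetric (n m : ℕ) where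
  /-- `coeff j p a b` is `g_{a b̄}` at the point with coordinates `p` over `U_j`. -/
  coeff : Fin n → (Fin n → ℂ) → Matrix (Fin n) (Fin n) ℂ
  smooth : ∀ j a b, ContDiff ℝ ∞ fun p => coeff j p a b
  posDef : ∀ j p, (coeff j p).PosDef
  compat : ∀ i j p, (param i p : X n m) ∈ domain j →
    coeff i p = pullback (fun q => coord j (param i q : X n m)) (coeff j) p
  kahler : ∀ j p a b c,
    dz c (fun q => coeff j q a b) p = dz a (fun q => coeff j q c b) p

namespace KahlerMetric

/-- Invariance under the action of `U(n)`. -/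
def RotationallySymmetric (g : KahlerMetric n m) : Prop :=
  ∀ (A : Matrix.unitaryGroup (Fin n) ℂ) (i j : Fin n) (p : Fin n → ℂ),
    rotate A (param i p : X n m) ∈ domain j →
      g.coeff i p = pullback (fun q => coord j (rotate A (param i q : X n m))) (g.coeff j) p

/-- On the complement of the zero section, pulled back to `ℂⁿ ∖ {0}`, the metric is
`∂_a ∂_b̄ u(log |z|²)`. -/
def HasRadialPotential (g : KahlerMetric n m) (u : ℝ → ℝ) : Prop :=
  ∀ (j : Fin n) (z : Fin n → ℂ), z j ≠ 0 →
    radialForm u z = pullback (coverCoord m j) (g.coeff j) z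

/-- The steady gradient Kähler-Ricci soliton equations `R_{a b̄} = f_{,a b̄}` and `f_{,a b} = 0` for
a smooth real function `f`. -/
def IsSteadyGradientSoliton (g : KahlerMetric n m) (f : X n m → ℝ) : Prop :=
  ∀ j : Fin n, ContDiff ℝ ∞ (fun p => f (param j p)) ∧ ∀ p a b,
    ricci (g.coeff j) a b p = dz a (dzbar b fun q => (f (param j q) : ℂ)) p ∧
    hess (g.coeff j) (fun q => (f (param j q) : ℂ)) a b p = 0

/-- `PathOfLength g x y L`: there is a piecewise `C¹` path of length `L` from `x` to `y`, a
concatenation of finitely many `C¹` curves each of which lies in a chart. -/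
inductive PathOfLength (g : KahlerMetric n m) (x : X n m) : X n m → ℝ → Prop
  | nil : PathOfLength g x x 0
  | snoc (L : ℝ) (j : Fin n) (c : ℝ → (Fin n → ℂ)) (hc : ContDiff ℝ 1 c)
      (h : PathOfLength g x (param j (c 0)) L) :
      PathOfLength g x (param j (c 1)) (L + curveLength (g.coeff j) c)

/-- The Riemannian distance. -/
def distance (g : KahlerMetric n m) (x y : X n m) : ℝ := sInf {L | g.PathOfLength x y L}

/-- Completeness of the Riemannian distance. -/
def IsComplete (g : KahlerMetric n m) : Prop :=
  ∀ s : ℕ → X n m,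
    (∀ ε : ℝ, 0 < ε → ∃ N, ∀ k l, N ≤ k → N ≤ l → g.distance (s k) (s l) < ε) →
    ∃ x, Filter.Tendsto (fun k => g.distance (s k) x) Filter.atTop (𝓝 0)

/-- The Gaussian curvature `- (2 / G) ∂_y ∂_ȳ log G` of the metric `G |dy|²` that `g` induces on the
fibre through the point with coordinates `p` over `U_j`; here `y` is the fibre coordinate and
`G = g_{j j̄}`. -/
def fibreCurvature (g : KahlerMetric n m) (j : Fin n) (p : Fin n → ℂ) : ℝ :=
  - (2 / (g.coeff j p j j).re) *
    (dz j (dzbar j fun q => ((Real.log (g.coeff j q j j).re : ℝ) : ℂ)) p).re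

end KahlerMetric

end LineBundleSoliton

end

noncomputable section

namespace LineBundleSoliton

open scoped ComplexConjugate

variable {n m : ℕ}

/-! ### Wirtinger calculus -/

/-! Write N = 1 + ∑ |z_k/z_j|² and s = |y|²N^m, the invariant function on X_m that equals e^{mt} off
the zero section. In every chart ∂∂̄u(t) = u' ∂∂̄t + u'' ∂t ⊗ ∂̄t, and its determinant off the zero
section is (u')^{n-1}u'' / (m²|y|²N^n).

Existence. For m = n put u'(t) = Φ(s). The equation for φ = u' becomes nΦ^{n-1}e^ΦΦ' = 1, which is
regular at s = 0, so it can be solved with Φ(0) = a (`exists_isProfile`). Since u'' = nsΦ'(s), the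
factor |y|² in s turns the singular ∂t into the smooth covector y∂t, and the metric extends over y =
0 as `solitonCoeff`. Its determinant is e^{-Φ}/n² (`det_solitonCoeff`), so Ric = ∂∂̄Φ and f = Φ(s).
Moreover ∂_bΦ = nȳ g_{b j̄}: the gradient of f is dual to the holomorphic field n y∂_y, so f_{,ab} =
0 (`hess_eq_of_dz_eq`). These identities are computed for y ≠ 0 and reach y = 0 by continuity.

Fibre curvature and completeness both rest on one inequality for Φ (`IsProfile.mul_rate_lt`). It
says that log Φ'(s) is strictly superharmonic in y, which is positive curvature of the fibres, and
it implies sΦ' ≤ 1. The latter makes f Lipschitz for the Riemannian distance; since f has compact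
sublevel sets, Cauchy sequences subconverge.

Uniqueness. By invariance f = F(t), and ∂_b f = (F'/u'') m ȳ g_{b j̄}. Then f_{,jj} = 0 forces
F'/u'' to be constant, so F = αφ + c (`exists_affine`). The Ricci equation in a direction tangent to
the base, along one fibre, reads (log φ^{n-1}φ')' + F' = n (`exists_log_eq`); integrating gives the
equation for φ. As t → -∞ the base component φ of g tends to some a > 0, while the fibre component
φ'/(m²e^{mt}) also has a positive limit. Hence e^{(n-m)t} has a positive limit, and m = n
(`degree_eq`). -/

/-- The real-linear map `ξ ↦ ∑ A_k ξ_k + B_k ξ̄_k`. -/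
def wirt (A B : Fin n → ℂ) : (Fin n → ℂ) →L[ℝ] ℂ :=
  ∑ k, (A k • (ContinuousLinearMap.proj k : (Fin n → ℂ) →L[ℝ] ℂ) +
    B k • (Complex.conjCLE : ℂ →L[ℝ] ℂ).comp (ContinuousLinearMap.proj k))

theorem wirt_apply (A B ξ : Fin n → ℂ) :
    wirt A B ξ = ∑ k, (A k * ξ k + B k * conj (ξ k)) := by
  simp [wirt]

/-- `F` is real-differentiable at `p` with `∂F/∂z_k = A k` and `∂F/∂z̄_k = B k`. -/
def HasW (F : (Fin n → ℂ) → ℂ) (A B : Fin n → ℂ) (p : Fin n → ℂ) : Prop :=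
  HasFDerivAt F (wirt A B) p

theorem wirt_single (A B : Fin n → ℂ) (k : Fin n) (c : ℂ) :
    wirt A B (Pi.single k c) = A k * c + B k * conj c := by
  rw [wirt_apply, Finset.sum_eq_single k]
  · simp
  · intro b _ hb
    simp [hb]
  · simp

theorem HasW.dz {F : (Fin n → ℂ) → ℂ} {A B p : Fin n → ℂ} (h : HasW F A B p) (k : Fin n) :
    dz k F p = A k := by
  unfold HasW at h
  rw [LineBundleSoliton.dz, h.fderiv, wirt_single, wirt_single, Complex.conj_I, map_one]
  linear_combination (-A k / 2 + B k / 2) * Complex.I_mul_I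

theorem HasW.dzbar {F : (Fin n → ℂ) → ℂ} {A B p : Fin n → ℂ} (h : HasW F A B p) (k : Fin n) :
    dzbar k F p = B k := by
  unfold HasW at h
  rw [LineBundleSoliton.dzbar, h.fderiv, wirt_single, wirt_single, Complex.conj_I, map_one]
  linear_combination (A k / 2 - B k / 2) * Complex.I_mul_I

/-- A real-linear map is a complex-linear plus an antilinear one, and its values on 1 and i in each
slot determine both parts. This provides every differentiable function with a `HasW`. -/
theorem eq_wirt (T : (Fin n → ℂ) →L[ℝ] ℂ) :
    T = wirt (fun k => (T (Pi.single k 1) - Complex.I * T (Pi.single k Complex.I)) / 2)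
      (fun k => (T (Pi.single k 1) + Complex.I * T (Pi.single k Complex.I)) / 2) := by
  ext ξ
  rw [wirt_apply]
  conv_lhs => rw [← Finset.univ_sum_single ξ, map_sum]
  refine Finset.sum_congr rfl fun k _ => ?_
  have h : (Pi.single k (ξ k) : Fin n → ℂ) =
      (ξ k).re • (Pi.single k 1 : Fin n → ℂ) + (ξ k).im • (Pi.single k Complex.I : Fin n → ℂ) := by
    rw [← Pi.single_smul, ← Pi.single_smul, ← Pi.single_add]
    congr 1
    apply Complex.ext <;> simp
  rw [h, map_add, map_smul, map_smul, Complex.real_smul, Complex.real_smul]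
  conv_rhs => rw [← Complex.re_add_im (ξ k)]
  simp only [map_add, map_mul, Complex.conj_ofReal, Complex.conj_I]
  linear_combination (T (Pi.single k Complex.I) * (ξ k).im) * Complex.I_mul_I

theorem hasW_of_differentiableAt {F : (Fin n → ℂ) → ℂ} {p : Fin n → ℂ}
    (h : DifferentiableAt ℝ F p) :
    HasW F (fun k => dz k F p) (fun k => dzbar k F p) p := by
  have := h.hasFDerivAt
  rw [eq_wirt (fderiv ℝ F p)] at this
  exact this

namespace HasW

variable {F G : (Fin n → ℂ) → ℂ} {A B A' B' p : Fin n → ℂ}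

theorem congr_of_eventuallyEq (h : HasW F A B p) (e : G =ᶠ[𝓝 p] F) : HasW G A B p :=
  HasFDerivAt.congr_of_eventuallyEq h e

theorem congr_coeff (h : HasW F A B p) (hA : ∀ k, A k = A' k) (hB : ∀ k, B k = B' k) :
    HasW F A' B' p := by
  rw [← funext hA, ← funext hB]; exact h

theorem const (c : ℂ) (p : Fin n → ℂ) : HasW (fun _ => c) 0 0 p := by
  refine (hasFDerivAt_const c p).congr_fderiv ?_
  ext ξ; simp [wirt_apply]

theorem add (h : HasW F A B p) (h' : HasW G A' B' p) :
    HasW (fun q => F q + G q) (fun k => A k + A' k) (fun k => B k + B' k) p := by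
  refine (HasFDerivAt.add h h').congr_fderiv ?_
  ext ξ
  simp only [add_apply, wirt_apply, ← Finset.sum_add_distrib]
  exact Finset.sum_congr rfl fun k _ => by ring

theorem mul (h : HasW F A B p) (h' : HasW G A' B' p) :
    HasW (fun q => F q * G q) (fun k => F p * A' k + G p * A k)
      (fun k => F p * B' k + G p * B k) p := by
  refine (HasFDerivAt.mul h h').congr_fderiv ?_
  ext ξ
  simp only [add_apply, smul_apply, smul_eq_mul,
    wirt_apply, Finset.mul_sum, ← Finset.sum_add_distrib]
  exact Finset.sum_congr rfl fun k _ => by ring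

theorem const_mul (c : ℂ) (h : HasW F A B p) :
    HasW (fun q => c * F q) (fun k => c * A k) (fun k => c * B k) p :=
  ((HasW.const c p).mul h).congr_coeff (fun k => by simp) (fun k => by simp)

theorem neg (h : HasW F A B p) : HasW (fun q => -F q) (fun k => -A k) (fun k => -B k) p := by
  simpa using h.const_mul (-1)

theorem sub (h : HasW F A B p) (h' : HasW G A' B' p) :
    HasW (fun q => F q - G q) (fun k => A k - A' k) (fun k => B k - B' k) p := by
  simpa [sub_eq_add_neg] using h.add h'.neg

theorem sum {ι : Type*} (s : Finset ι) {F : ι → (Fin n → ℂ) → ℂ} {A B : ι → Fin n → ℂ}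
    (h : ∀ i ∈ s, HasW (F i) (A i) (B i) p) :
    HasW (fun q => ∑ i ∈ s, F i q) (fun k => ∑ i ∈ s, A i k) (fun k => ∑ i ∈ s, B i k) p := by
  classical
  induction s using Finset.induction_on with
  | empty => simp only [Finset.sum_empty]; exact HasW.const 0 p
  | insert i s hi ih =>
    have h1 := (h i (Finset.mem_insert_self i s)).add
      (ih fun j hj => h j (Finset.mem_insert_of_mem hj))
    simpa [Finset.sum_insert hi] using h1

theorem conjugate (h : HasW F A B p) :
    HasW (fun q => conj (F q)) (fun k => conj (B k)) (fun k => conj (A k)) p := by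
  refine ((Complex.conjCLE : ℂ →L[ℝ] ℂ).hasFDerivAt.comp p h).congr_fderiv ?_
  ext ξ
  simp only [ContinuousLinearMap.comp_apply, wirt_apply]
  simp only [ContinuousLinearEquiv.coe_coe, Complex.conjCLE_apply, map_sum, map_add, map_mul,
    Complex.conj_conj]
  exact Finset.sum_congr rfl fun k _ => by ring

theorem coord (p : Fin n → ℂ) (j : Fin n) :
    HasW (fun q => q j) (Pi.single j 1) 0 p := by
  refine (hasFDerivAt_apply j p).congr_fderiv ?_
  ext ξ
  rw [wirt_apply, Finset.sum_eq_single j]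
  · simp
  · intro b _ hb
    simp [hb]
  · simp

theorem inv (h : HasW F A B p) (h0 : F p ≠ 0) :
    HasW (fun q => (F q)⁻¹) (fun k => -A k / F p ^ 2) (fun k => -B k / F p ^ 2) p := by
  have h1 : HasFDerivAt (fun x : ℂ => x⁻¹) _ (F p) :=
    (hasDerivAt_inv h0).hasFDerivAt.restrictScalars ℝ
  refine (h1.comp p h).congr_fderiv ?_
  ext ξ
  simp only [ContinuousLinearMap.comp_apply, wirt_apply, ContinuousLinearMap.coe_restrictScalars',
    ContinuousLinearMap.toSpanSingleton_apply, smul_eq_mul, Finset.sum_mul]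
  exact Finset.sum_congr rfl fun k _ => by ring

theorem ofReal_comp {t : (Fin n → ℂ) → ℝ} {ψ : ℝ → ℝ} {ψ' : ℝ}
    (h : HasW (fun q => (t q : ℂ)) A B p) (hψ : HasDerivAt ψ ψ' (t p)) :
    HasW (fun q => (ψ (t q) : ℂ)) (fun k => ψ' * A k) (fun k => ψ' * B k) p := by
  have ht : HasFDerivAt t (Complex.reCLM.comp (wirt A B)) p := by
    simpa [Function.comp_def] using Complex.reCLM.hasFDerivAt.comp p h
  have h1 := Complex.ofRealCLM.hasFDerivAt.comp p (hψ.hasFDerivAt.comp p ht)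
  have h2 := Complex.ofRealCLM.hasFDerivAt.comp p ht
  -- Two derivatives of the same real function are compared: the map takes real values, so passing
  -- to real parts and back loses nothing.
  have h3 : wirt A B = Complex.ofRealCLM.comp (Complex.reCLM.comp (wirt A B)) :=
    HasFDerivAt.unique h h2
  refine HasFDerivAt.congr_fderiv h1 ?_
  ext ξ
  have h4 := DFunLike.congr_fun h3 ξ
  have h5 : wirt (fun k => (ψ' : ℂ) * A k) (fun k => (ψ' : ℂ) * B k) ξ = ψ' * wirt A B ξ := by
    simp only [wirt_apply, Finset.mul_sum]
    exact Finset.sum_congr rfl fun k _ => by ring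
  rw [h5, h4]
  simp [mul_comm]

theorem of_holomorphic {F' : (Fin n → ℂ) →L[ℂ] ℂ} (h : HasFDerivAt F F' p) :
    HasW F (fun k => F' (Pi.single k 1)) 0 p := by
  refine (h.restrictScalars ℝ).congr_fderiv ?_
  ext ξ
  rw [wirt_apply, ContinuousLinearMap.coe_restrictScalars']
  conv_lhs => rw [← Finset.univ_sum_single ξ, map_sum]
  refine Finset.sum_congr rfl fun k _ => ?_
  have : (Pi.single k (ξ k) : Fin n → ℂ) = ξ k • Pi.single k 1 := by
    rw [← Pi.single_smul]; simp
  rw [this, map_smul]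
  simp [mul_comm]


/-- Chain rule for a holomorphic change of coordinates. -/
theorem comp_holomorphic {τ : (Fin n → ℂ) → (Fin n → ℂ)} (h : HasW F A B (τ p))
    (hτ : DifferentiableAt ℂ τ p) :
    HasW (fun q => F (τ q)) (fun a => ∑ k, A k * jac τ p k a)
      (fun a => ∑ k, B k * conj (jac τ p k a)) p := by
  refine (HasFDerivAt.comp p h (hτ.hasFDerivAt.restrictScalars ℝ)).congr_fderiv ?_
  ext ξ
  have hJ : ∀ k, fderiv ℂ τ p ξ k = ∑ a, jac τ p k a * ξ a := by
    intro k
    conv_lhs => rw [← Finset.univ_sum_single ξ, map_sum, Finset.sum_apply]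
    refine Finset.sum_congr rfl fun a _ => ?_
    have : (Pi.single a (ξ a) : Fin n → ℂ) = ξ a • Pi.single a 1 := by
      rw [← Pi.single_smul]; simp
    rw [this, map_smul]
    simp [jac, mul_comm]
  rw [ContinuousLinearMap.comp_apply, ContinuousLinearMap.coe_restrictScalars', wirt_apply,
    wirt_apply]
  simp only [hJ, map_sum, map_mul, Finset.mul_sum, ← Finset.sum_add_distrib, Finset.sum_mul]
  rw [Finset.sum_comm]
  exact Finset.sum_congr rfl fun a _ => Finset.sum_congr rfl fun k _ => by ring

end HasW

/-! ### Second derivatives and holomorphic changes of coordinates -/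

theorem dz_congr {F G : (Fin n → ℂ) → ℂ} {p : Fin n → ℂ} (h : F =ᶠ[𝓝 p] G) (k : Fin n) :
    dz k F p = dz k G p := by
  rw [dz, dz, h.fderiv_eq]

theorem dzbar_congr {F G : (Fin n → ℂ) → ℂ} {p : Fin n → ℂ} (h : F =ᶠ[𝓝 p] G) (k : Fin n) :
    dzbar k F p = dzbar k G p := by
  rw [dzbar, dzbar, h.fderiv_eq]

theorem dzbar_eventuallyEq {F G : (Fin n → ℂ) → ℂ} {p : Fin n → ℂ} (h : F =ᶠ[𝓝 p] G)
    (k : Fin n) : dzbar k F =ᶠ[𝓝 p] dzbar k G := by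
  filter_upwards [h.eventuallyEq_nhds] with q hq using dzbar_congr hq k

theorem contDiffAt_fderiv_apply {F : (Fin n → ℂ) → ℂ} {p : Fin n → ℂ}
    (h : ContDiffAt ℝ ∞ F p) (w : Fin n → ℂ) :
    ContDiffAt ℝ ∞ (fun q => fderiv ℝ F q w) p :=
  (h.fderiv_right (by simp)).clm_apply contDiffAt_const

theorem ContDiffAt.dz {F : (Fin n → ℂ) → ℂ} {p : Fin n → ℂ}
    (h : ContDiffAt ℝ ∞ F p) (k : Fin n) : ContDiffAt ℝ ∞ (dz k F) p :=
  ((contDiffAt_fderiv_apply h _).sub (contDiffAt_const.mul (contDiffAt_fderiv_apply h _))).div_const 2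

theorem ContDiffAt.dzbar {F : (Fin n → ℂ) → ℂ} {p : Fin n → ℂ}
    (h : ContDiffAt ℝ ∞ F p) (k : Fin n) : ContDiffAt ℝ ∞ (dzbar k F) p :=
  ((contDiffAt_fderiv_apply h _).add (contDiffAt_const.mul (contDiffAt_fderiv_apply h _))).div_const 2

theorem dz_dz_comm {F : (Fin n → ℂ) → ℂ} {p : Fin n → ℂ} (h : ContDiffAt ℝ ∞ F p)
    (a b : Fin n) : dz a (dz b F) p = dz b (dz a F) p := by
  have hsymm : IsSymmSndFDerivAt ℝ F p := h.isSymmSndFDerivAt (by simpa using ENat.LEInfty.out)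
  have hd : DifferentiableAt ℝ (fderiv ℝ F) p :=
    (h.fderiv_right (m := ∞) (by simp)).differentiableAt (by simp)
  have key : ∀ (c : Fin n) (w : Fin n → ℂ), fderiv ℝ (dz c F) p w =
      (fderiv ℝ (fderiv ℝ F) p w (Pi.single c 1) -
        Complex.I * fderiv ℝ (fderiv ℝ F) p w (Pi.single c Complex.I)) / 2 := by
    intro c w
    have h1 : ∀ v, HasFDerivAt (fun q => fderiv ℝ F q v)
        ((fderiv ℝ (fderiv ℝ F) p).flip v) p := fun v => by
      simpa using hd.hasFDerivAt.clm_apply (hasFDerivAt_const v p)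
    have h2 : HasFDerivAt (dz c F) _ p :=
      ((h1 (Pi.single c 1)).sub ((h1 (Pi.single c Complex.I)).const_mul Complex.I)).mul_const
        (2⁻¹ : ℂ)
    rw [h2.fderiv]
    simp
    ring
  rw [dz, dz, key, key, key, key, hsymm (Pi.single b 1) (Pi.single a 1),
    hsymm (Pi.single b 1) (Pi.single a Complex.I),
    hsymm (Pi.single b Complex.I) (Pi.single a 1),
    hsymm (Pi.single b Complex.I) (Pi.single a Complex.I)]
  ring

/-- The matrix of mixed second derivatives `∂_a ∂_b̄ F`. -/
def ddbar (F : (Fin n → ℂ) → ℂ) (p : Fin n → ℂ) : Matrix (Fin n) (Fin n) ℂ :=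
  Matrix.of fun a b => dz a (dzbar b F) p

theorem ddbar_apply (F : (Fin n → ℂ) → ℂ) (p : Fin n → ℂ) (a b : Fin n) :
    ddbar F p a b = dz a (dzbar b F) p := rfl

theorem ddbar_congr {F G : (Fin n → ℂ) → ℂ} {p : Fin n → ℂ} (h : F =ᶠ[𝓝 p] G) :
    ddbar F p = ddbar G p := by
  ext a b
  exact dz_congr (dzbar_eventuallyEq h b) a

theorem pullback_apply (τ : (Fin n → ℂ) → (Fin n → ℂ))
    (h : (Fin n → ℂ) → Matrix (Fin n) (Fin n) ℂ) (p : Fin n → ℂ) (a b : Fin n) :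
    pullback τ h p a b = ∑ l, (∑ k, jac τ p k a * h (τ p) k l) * conj (jac τ p l b) := by
  simp [pullback, Matrix.mul_apply]

theorem differentiableAt_jac {τ : (Fin n → ℂ) → (Fin n → ℂ)} {p : Fin n → ℂ}
    (hτ : ContDiffAt ℂ ∞ τ p) (k a : Fin n) :
    DifferentiableAt ℂ (fun q => jac τ q k a) p := by
  have h1 : DifferentiableAt ℂ (fderiv ℂ τ) p :=
    (hτ.fderiv_right (m := ∞) (by simp)).differentiableAt (by simp)
  exact differentiableAt_pi.1 (h1.clm_apply (differentiableAt_const (Pi.single a (1 : ℂ)))) k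

/-- The antiholomorphic factor conj(∂_bτ_k) is annihilated by ∂_a, so no second derivatives of τ
appear and ∂∂̄F transforms as a tensor. -/
theorem ddbar_comp {F : (Fin n → ℂ) → ℂ} {τ : (Fin n → ℂ) → (Fin n → ℂ)} {p : Fin n → ℂ}
    (hF : ContDiffAt ℝ ∞ F (τ p)) (hτ : ContDiffAt ℂ ∞ τ p) :
    ddbar (fun q => F (τ q)) p = pullback τ (ddbar F) p := by
  ext a b
  have e1 : dzbar b (fun q => F (τ q)) =ᶠ[𝓝 p]
      fun q => ∑ k, dzbar k F (τ q) * conj (jac τ q k b) := by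
    have hF1 : ∀ᶠ q in 𝓝 p, ContDiffAt ℝ 1 F (τ q) :=
      hτ.continuousAt.eventually ((hF.of_le (by simp)).eventually (by simp))
    have hτ1 : ∀ᶠ q in 𝓝 p, ContDiffAt ℂ 1 τ q :=
      (hτ.of_le (by simp)).eventually (by simp)
    filter_upwards [hF1, hτ1] with q h1 h2
    exact ((hasW_of_differentiableAt (h1.differentiableAt (by simp))).comp_holomorphic
      (h2.differentiableAt (by simp))).dzbar b
  have hd : DifferentiableAt ℂ τ p := hτ.differentiableAt (by simp)
  rw [ddbar_apply, dz_congr e1 a, pullback_apply]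
  have h1 : ∀ k ∈ Finset.univ, HasW (fun q => dzbar k F (τ q) * conj (jac τ q k b)) _ _ p :=
    fun k _ => ((hasW_of_differentiableAt ((ContDiffAt.dzbar hF k).differentiableAt
      (by simp))).comp_holomorphic hd).mul
        (HasW.of_holomorphic (differentiableAt_jac hτ k b).hasFDerivAt).conjugate
  rw [(HasW.sum _ h1).dz a]
  refine Finset.sum_congr rfl fun l _ => ?_
  simp only [Pi.zero_apply, map_zero, mul_zero, zero_add, ddbar_apply]
  rw [mul_comm]
  congr 1
  exact Finset.sum_congr rfl fun k _ => mul_comm _ _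

theorem hasDerivAt_deriv_of_contDiffAt {ψ : ℝ → ℝ} {x : ℝ} (h : ContDiffAt ℝ ∞ ψ x) :
    HasDerivAt (deriv ψ) (deriv (deriv ψ) x) x := by
  have h1 : ContDiffAt ℝ ∞ (fun x => fderiv ℝ ψ x 1) x :=
    (h.fderiv_right (by simp)).clm_apply contDiffAt_const
  exact (h1.differentiableAt (by simp)).hasDerivAt

/-- The rule ∂∂̄(ψ∘t) = ψ' ∂∂̄t + ψ'' ∂t ⊗ ∂̄t. It is used both for |z|² on ℂⁿ and for the charts.
-/
theorem ddbar_ofReal_comp {t : (Fin n → ℂ) → ℝ} {A B : (Fin n → ℂ) → Fin n → ℂ}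
    {C C' : Fin n → Fin n → ℂ} {p : Fin n → ℂ} {ψ : ℝ → ℝ}
    (ht : ∀ᶠ q in 𝓝 p, HasW (fun q => (t q : ℂ)) (A q) (B q) q)
    (hB : ∀ b, HasW (fun q => B q b) (C b) (C' b) p)
    (hψ : ContDiffAt ℝ ∞ ψ (t p)) (a b : Fin n) :
    ddbar (fun q => (ψ (t q) : ℂ)) p a b =
      deriv ψ (t p) * C b a + deriv (deriv ψ) (t p) * (A p a * B p b) := by
  have htp := ht.self_of_nhds
  have htc : ContinuousAt t p := by
    have : ContinuousAt (fun q => ((t q : ℂ)).re) p :=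
      Complex.continuous_re.continuousAt.comp (HasFDerivAt.continuousAt htp)
    simpa using this
  have e1 : dzbar b (fun q => (ψ (t q) : ℂ)) =ᶠ[𝓝 p]
      fun q => ((deriv ψ (t q) : ℝ) : ℂ) * B q b := by
    have h1 : ∀ᶠ q in 𝓝 p, ContDiffAt ℝ 1 ψ (t q) :=
      htc.eventually ((hψ.of_le (by simp)).eventually (by simp))
    filter_upwards [ht, h1] with q h2 h3
    exact (h2.ofReal_comp (h3.differentiableAt (by simp)).hasDerivAt).dzbar b
  rw [ddbar_apply, dz_congr e1 a, ((htp.ofReal_comp (hasDerivAt_deriv_of_contDiffAt hψ)).mul (hB b)).dz a]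
  ring

/-! ### The invariant function `|y|² |z|²ᵐ` on `X_m` -/

theorem normSq_nonneg (z : Fin n → ℂ) : 0 ≤ normSq z := Finset.sum_nonneg fun _ _ => sq_nonneg _

theorem normSq_pos {z : Fin n → ℂ} (hz : z ≠ 0) : 0 < normSq z := by
  obtain ⟨k, hk⟩ := Function.ne_iff.1 hz
  exact Finset.sum_pos' (fun _ _ => sq_nonneg _) ⟨k, Finset.mem_univ k, by
    have := norm_pos_iff.2 hk
    positivity⟩

theorem ofReal_normSq (z : Fin n → ℂ) : (normSq z : ℂ) = ∑ k, z k * conj (z k) := by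
  simp [normSq, Complex.mul_conj, Complex.normSq_eq_norm_sq]

theorem normSq_smul (c : ℂ) (z : Fin n → ℂ) : normSq (c • z) = ‖c‖ ^ 2 * normSq z := by
  simp [normSq, Finset.mul_sum, mul_pow]

theorem normSq_mulVec (A : Matrix.unitaryGroup (Fin n) ℂ) (z : Fin n → ℂ) :
    normSq (A.1.mulVec z) = normSq z := by
  have h : ∀ w : Fin n → ℂ, (normSq w : ℂ) = star w ⬝ᵥ w := fun w => by
    rw [ofReal_normSq]
    exact Finset.sum_congr rfl fun k _ => mul_comm _ _
  apply Complex.ofReal_injective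
  rw [h, h, Matrix.star_mulVec, ← Matrix.dotProduct_mulVec, Matrix.mulVec_mulVec,
    ← Matrix.star_eq_conjTranspose, Matrix.UnitaryGroup.star_mul_self, Matrix.one_mulVec]

theorem contDiff_normSq : ContDiff ℝ ∞ (normSq : (Fin n → ℂ) → ℝ) :=
  ContDiff.sum fun k _ => (contDiff_apply ℝ ℂ k).norm_sq ℝ

/-- The function `|y|² |z|²ᵐ` on `X_m`. -/
def fibreNormSq : X n m → ℝ :=
  Quotient.lift (s := totalSetoid n m) (fun q => ‖q.1.2‖ ^ 2 * normSq q.1.1 ^ m) (by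
    rintro q q' ⟨c, hc, h1, h2⟩
    simp only [h1, h2, normSq_smul, norm_mul, norm_pow]
    ring)

theorem fibreNormSq_mk (q : PreTotal n) :
    fibreNormSq (mk m q) = ‖q.1.2‖ ^ 2 * normSq q.1.1 ^ m := rfl

theorem fibreNormSq_nonneg (x : X n m) : 0 ≤ fibreNormSq x := by
  induction x using Quotient.inductionOn with
  | h q => exact mul_nonneg (sq_nonneg _) (pow_nonneg (normSq_nonneg _) _)

theorem fibreNormSq_rotate (A : Matrix.unitaryGroup (Fin n) ℂ) (x : X n m) :
    fibreNormSq (rotate A x) = fibreNormSq x := by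
  induction x using Quotient.inductionOn with
  | h q =>
    change ‖q.1.2‖ ^ 2 * normSq (A.1.mulVec q.1.1) ^ m = ‖q.1.2‖ ^ 2 * normSq q.1.1 ^ m
    rw [normSq_mulVec]

theorem fibreNormSq_cover (z : Fin n → ℂ) (hz : z ≠ 0) :
    fibreNormSq (cover m z hz) = normSq z ^ m := by
  simp [cover, fibreNormSq_mk]

theorem param_coord {j : Fin n} {x : X n m} (hx : x ∈ domain j) : param j (coord j x) = x :=
  (chart j).left_inv hx

/-- `1 + ∑ |z_k / z_j|²` in the coordinates over `U_j`. -/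
def baseNormSq (j : Fin n) (p : Fin n → ℂ) : ℝ := normSq (Function.update p j 1)

theorem baseNormSq_pos (j : Fin n) (p : Fin n → ℂ) : 0 < baseNormSq j p :=
  normSq_pos (update_one_ne_zero j p)

theorem baseNormSq_eq (j : Fin n) (p : Fin n → ℂ) :
    baseNormSq j p = 1 + normSq (Function.update p j 0) := by
  have h : ∀ c : ℂ, normSq (Function.update p j c) =
      ‖c‖ ^ 2 + ∑ k ∈ Finset.univ.erase j, ‖p k‖ ^ 2 := fun c => by
    rw [normSq, ← Finset.add_sum_erase _ _ (Finset.mem_univ j), Function.update_self]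
    congr 1
    exact Finset.sum_congr rfl fun k hk => by rw [Function.update_of_ne (Finset.ne_of_mem_erase hk)]
  rw [baseNormSq, h, h]
  simp

theorem contDiff_update (j : Fin n) (c : ℂ) :
    ContDiff ℝ ∞ fun p : Fin n → ℂ => Function.update p j c := by
  refine contDiff_pi.2 fun k => ?_
  by_cases h : k = j
  · subst h; simpa using contDiff_const
  · simpa [h] using contDiff_apply ℝ ℂ k

theorem contDiff_baseNormSq (j : Fin n) :
    ContDiff ℝ ∞ (baseNormSq j : (Fin n → ℂ) → ℝ) :=
  contDiff_normSq.comp (contDiff_update j 1)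

theorem fibreNormSq_param (j : Fin n) (p : Fin n → ℂ) :
    fibreNormSq (param j p : X n m) = ‖p j‖ ^ 2 * baseNormSq j p ^ m := rfl

theorem contDiff_fibreNormSq_param (j : Fin n) :
    ContDiff ℝ ∞ fun p => fibreNormSq (param j p : X n m) :=
  ((contDiff_apply ℝ ℂ j).norm_sq ℝ).mul ((contDiff_baseNormSq j).pow m)

theorem fibreNormSq_param_ne_zero (j : Fin n) (p : Fin n → ℂ) :
    fibreNormSq (param j p : X n m) ≠ 0 ↔ p j ≠ 0 := by
  rw [fibreNormSq_param]
  simp [(baseNormSq_pos j p).ne']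

/-- `log |z|²` in the coordinates over `U_j`. -/
def logCoord (m : ℕ) (j : Fin n) (p : Fin n → ℂ) : ℝ :=
  Real.log (fibreNormSq (param j p : X n m)) / m

theorem logCoord_eq (hm : m ≠ 0) (j : Fin n) {p : Fin n → ℂ} (hp : p j ≠ 0) :
    logCoord m j p = Real.log (‖p j‖ ^ 2) / m + Real.log (baseNormSq j p) := by
  have : (m : ℝ) ≠ 0 := Nat.cast_ne_zero.2 hm
  have h1 := norm_pos_iff.2 hp
  rw [logCoord, fibreNormSq_param, Real.log_mul (by positivity)
    (pow_pos (baseNormSq_pos j p) m).ne', Real.log_pow (baseNormSq j p)]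
  field_simp

theorem exp_logCoord (hm : m ≠ 0) (j : Fin n) {p : Fin n → ℂ} (hp : p j ≠ 0) :
    Real.exp (m * logCoord m j p) = fibreNormSq (param j p : X n m) := by
  have : (m : ℝ) ≠ 0 := Nat.cast_ne_zero.2 hm
  rw [logCoord, mul_div_cancel₀ _ this, Real.exp_log]
  exact lt_of_le_of_ne (fibreNormSq_nonneg _) ((fibreNormSq_param_ne_zero j p).2 hp).symm

theorem contDiffAt_logCoord (j : Fin n) {p : Fin n → ℂ} (hp : p j ≠ 0) :
    ContDiffAt ℝ ∞ (logCoord m j) p :=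
  ((contDiff_fibreNormSq_param j).contDiffAt.log
    ((fibreNormSq_param_ne_zero j p).2 hp)).div_const _

/-! ### Wirtinger derivatives of `log |z|²` -/

theorem hasW_normSq (p : Fin n → ℂ) :
    HasW (fun q => (normSq q : ℂ)) (fun a => conj (p a)) p p := by
  have h := HasW.sum Finset.univ fun k _ => (HasW.coord p k).mul (HasW.coord p k).conjugate
  refine (h.congr_of_eventuallyEq (.of_forall fun q => ofReal_normSq q)).congr_coeff ?_ ?_
  · intro a
    simp [Pi.single_apply]
  · intro a
    simp [Pi.single_apply, apply_ite]

theorem hasW_update (j : Fin n) (c : ℂ) (p : Fin n → ℂ) (k : Fin n) :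
    HasW (fun q => Function.update q j c k) (fun a => if a = k ∧ k ≠ j then 1 else 0) 0 p := by
  by_cases h : k = j
  · subst h
    exact ((HasW.const c p).congr_of_eventuallyEq (.of_forall fun q => by simp)).congr_coeff
      (fun a => by simp) fun a => rfl
  · simp only [Function.update_of_ne h]
    exact (HasW.coord p k).congr_coeff (fun a => by simp [h, Pi.single_apply]) fun _ => rfl

theorem hasW_baseNormSq (j : Fin n) (p : Fin n → ℂ) :
    HasW (fun q => (baseNormSq j q : ℂ)) (fun a => conj (Function.update p j 0 a))
      (Function.update p j 0) p := by
  have h := (HasW.const 1 p).add (HasW.sum Finset.univ fun k _ =>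
    (hasW_update j 0 p k).mul (hasW_update j 0 p k).conjugate)
  refine (h.congr_of_eventuallyEq (.of_forall fun q => ?_)).congr_coeff ?_ ?_
  · simp only [baseNormSq_eq, ← ofReal_normSq, Complex.ofReal_add, Complex.ofReal_one]
  · intro a
    by_cases ha : a = j
    · subst ha
      simp +contextual [ite_and]
    · simp only [Pi.zero_apply, map_zero, mul_zero, zero_add]
      rw [Finset.sum_eq_single a]
      · simp [ha]
      · intro b _ hb
        simp [hb.symm]
      · simp
  · intro a
    by_cases ha : a = j
    · subst ha
      simp +contextual [ite_and]
    · simp only [Pi.zero_apply, mul_zero, zero_add, add_zero]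
      rw [Finset.sum_eq_single a]
      · simp [ha]
      · intro b _ hb
        simp [hb.symm]
      · simp

/-- The derivatives `∂_b̄ log |z|²` in the coordinates over `U_j`. -/
def dbarLog (m : ℕ) (j : Fin n) (p : Fin n → ℂ) (b : Fin n) : ℂ :=
  (if b = j then (m * conj (p j))⁻¹ else 0) + Function.update p j 0 b / baseNormSq j p

theorem hasW_logCoord (hm : m ≠ 0) (j : Fin n) {p : Fin n → ℂ} (hp : p j ≠ 0) :
    HasW (fun q => (logCoord m j q : ℂ)) (fun a => conj (dbarLog m j p a)) (dbarLog m j p) p := by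
  have hm' : (m : ℂ) ≠ 0 := Nat.cast_ne_zero.2 hm
  have hc : conj (p j) ≠ 0 := by simpa using hp
  have hN : (baseNormSq j p : ℂ) ≠ 0 := Complex.ofReal_ne_zero.2 (baseNormSq_pos j p).ne'
  have hn : (‖p j‖ ^ 2 : ℝ) ≠ 0 := by simpa using hp
  have h1 : HasW (fun q => ((‖q j‖ ^ 2 : ℝ) : ℂ)) _ _ p :=
    ((HasW.coord p j).mul (HasW.coord p j).conjugate).congr_of_eventuallyEq
      (.of_forall fun q => by simp [Complex.mul_conj, Complex.normSq_eq_norm_sq])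
  have h2 := ((h1.ofReal_comp (Real.hasDerivAt_log hn)).const_mul (m : ℂ)⁻¹).add
    ((hasW_baseNormSq j p).ofReal_comp (Real.hasDerivAt_log (baseNormSq_pos j p).ne'))
  have h3 : ((‖p j‖ ^ 2 : ℝ) : ℂ) = p j * conj (p j) := by
    simp [Complex.mul_conj, Complex.normSq_eq_norm_sq]
  have e : ∀ᶠ q in 𝓝 p, q j ≠ 0 := (continuous_apply j).continuousAt.eventually_ne hp
  refine (h2.congr_of_eventuallyEq ?_).congr_coeff ?_ ?_
  · filter_upwards [e] with q hq
    rw [logCoord_eq hm j hq]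
    push_cast
    ring
  · intro a
    rw [Complex.ofReal_inv, h3]
    by_cases ha : a = j
    · subst ha
      simp [dbarLog]
      field_simp
    · simp [dbarLog, ha]
      field_simp
  · intro a
    rw [Complex.ofReal_inv, h3]
    by_cases ha : a = j
    · subst ha
      simp [dbarLog]
      field_simp
    · simp [dbarLog, ha]
      field_simp

/-- The components of `∂∂̄ log |z|²` in the coordinates over `U_j`. -/
def fubiniStudy (j : Fin n) (p : Fin n → ℂ) : Matrix (Fin n) (Fin n) ℂ :=
  Matrix.of fun a b => (if a = b ∧ b ≠ j then (baseNormSq j p : ℂ)⁻¹ else 0) -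
    conj (Function.update p j 0 a) * Function.update p j 0 b / baseNormSq j p ^ 2

theorem hasW_dbarLog (j : Fin n) {p : Fin n → ℂ} (hp : m ≠ 0 → p j ≠ 0) (b : Fin n) :
    ∃ C', HasW (fun q => dbarLog m j q b) (fun a => fubiniStudy j p a b) C' p := by
  have hN : (baseNormSq j p : ℂ) ≠ 0 := Complex.ofReal_ne_zero.2 (baseNormSq_pos j p).ne'
  have h1 := (hasW_update j 0 p b).mul ((hasW_baseNormSq j p).inv hN)
  have h2 : ∃ D, HasW (fun q : Fin n → ℂ => if b = j then (m * conj (q j))⁻¹ else 0) 0 D p := by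
    by_cases hb : b = j
    · simp only [hb, if_true]
      -- For m = 0 the term is the inverse of zero, that is, the constant 0, and no condition on p j
      -- is needed.
      by_cases hm : m = 0
      · subst hm
        simp only [Nat.cast_zero, zero_mul, inv_zero]
        exact ⟨_, HasW.const 0 p⟩
      · refine ⟨_, ((((HasW.coord p j).conjugate).const_mul (m : ℂ)).inv ?_).congr_coeff ?_
          fun k => rfl⟩
        · simpa [hm] using hp hm
        · simp
    · simp only [hb, if_false]
      exact ⟨_, HasW.const 0 p⟩
  obtain ⟨D, hD⟩ := h2
  refine ⟨_, ((hD.add h1).congr_of_eventuallyEq (.of_forall fun q => ?_)).congr_coeff ?_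
    fun k => rfl⟩
  · simp [dbarLog, div_eq_mul_inv]
  · intro a
    by_cases hb : b = j
    · subst hb; simp [fubiniStudy]
    · by_cases hab : a = b
      · subst hab
        simp [fubiniStudy, hb]
        field_simp
        ring
      · simp [fubiniStudy, hab]
        field_simp

theorem ddbar_comp_logCoord (hm : m ≠ 0) (j : Fin n) {p : Fin n → ℂ} (hp : p j ≠ 0) {ψ : ℝ → ℝ}
    (hψ : ContDiffAt ℝ ∞ ψ (logCoord m j p)) (a b : Fin n) :
    ddbar (fun q => (ψ (logCoord m j q) : ℂ)) p a b =
      deriv ψ (logCoord m j p) * fubiniStudy j p a b +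
        deriv (deriv ψ) (logCoord m j p) * (conj (dbarLog m j p a) * dbarLog m j p b) := by
  have e : ∀ᶠ q in 𝓝 p, q j ≠ 0 := (continuous_apply j).continuousAt.eventually_ne hp
  choose C' hC' using hasW_dbarLog (m := m) j fun _ => hp
  exact ddbar_ofReal_comp (e.mono fun q hq => hasW_logCoord hm j hq) hC' hψ a b

/-! ### The potential on `ℂⁿ ∖ {0}` -/

theorem radialForm_apply {u : ℝ → ℝ} (hu : ContDiff ℝ ∞ u) {z : Fin n → ℂ} (hz : z ≠ 0)
    (a b : Fin n) :
    radialForm u z a b = deriv u (Real.log (normSq z)) *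
        ((if a = b then (normSq z : ℂ)⁻¹ else 0) - conj (z a) * z b / normSq z ^ 2) +
      deriv (deriv u) (Real.log (normSq z)) * (conj (z a) * z b / normSq z ^ 2) := by
  have e : ∀ᶠ q : Fin n → ℂ in 𝓝 z, q ≠ 0 := eventually_ne_nhds hz
  have hN : ∀ {q : Fin n → ℂ}, q ≠ 0 → (normSq q : ℂ) ≠ 0 := fun hq =>
    Complex.ofReal_ne_zero.2 (normSq_pos hq).ne'
  have h1 : ∀ q : Fin n → ℂ, q ≠ 0 → HasW (fun q => (Real.log (normSq q) : ℂ))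
      (fun a => conj (q a) * (normSq q : ℂ)⁻¹) (fun b => q b * (normSq q : ℂ)⁻¹) q := fun q hq => by
    refine ((hasW_normSq q).ofReal_comp (Real.hasDerivAt_log (normSq_pos hq).ne')).congr_coeff
      ?_ ?_ <;> intro k <;> push_cast <;> ring
  have h2 : ∀ b, HasW (fun q : Fin n → ℂ => q b * (normSq q : ℂ)⁻¹) _ _ z := fun b =>
    (HasW.coord z b).mul ((hasW_normSq z).inv (hN hz))
  have h := ddbar_ofReal_comp (e.mono h1) h2 hu.contDiffAt a b
  refine h.trans ?_
  have := hN hz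
  congr 1
  · congr 1
    by_cases hab : a = b
    · subst hab; simp; field_simp; ring
    · simp [hab]; field_simp
  · field_simp

theorem det_one_add_vecMulVec (u v : Fin n → ℂ) :
    (1 + Matrix.vecMulVec u v).det = 1 + v ⬝ᵥ u := by
  rw [← Matrix.det_one_add_replicateCol_mul_replicateRow (ι := Unit), Matrix.vecMulVec_eq Unit]

/-- The form is φ/|z|² times a rank-one perturbation of the identity, so the matrix determinant
lemma applies; φ ≠ 0 is needed to factor it out. -/
theorem det_radialForm {u : ℝ → ℝ} (hu : ContDiff ℝ ∞ u) {z : Fin n → ℂ} (hz : z ≠ 0)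
    (hφ : deriv u (Real.log (normSq z)) ≠ 0) :
    (radialForm u z).det = ((deriv u (Real.log (normSq z)) ^ (n - 1) *
      deriv (deriv u) (Real.log (normSq z)) * Real.exp (-(n * Real.log (normSq z))) : ℝ) : ℂ) := by
  set φ := deriv u (Real.log (normSq z)) with hφdef
  set φ' := deriv (deriv u) (Real.log (normSq z)) with hφ'def
  have hN : (normSq z : ℂ) ≠ 0 := Complex.ofReal_ne_zero.2 (normSq_pos hz).ne'
  have hφc : (φ : ℂ) ≠ 0 := Complex.ofReal_ne_zero.2 hφ
  have h1 : radialForm u z = ((φ : ℂ) / normSq z) •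
      (1 + Matrix.vecMulVec (fun a => ((φ' - φ) / (φ * normSq z) : ℂ) * conj (z a)) z) := by
    ext a b
    rw [radialForm_apply hu hz, ← hφdef, ← hφ'def]
    simp only [Matrix.smul_apply, Matrix.add_apply, Matrix.vecMulVec_apply, smul_eq_mul,
      Matrix.one_apply]
    by_cases hab : a = b
    · simp [hab]; field_simp; ring
    · simp [hab]; field_simp; ring
  have h2 : z ⬝ᵥ (fun a => ((φ' - φ) / (φ * normSq z) : ℂ) * conj (z a)) = (φ' - φ) / φ := by
    have : ∀ a, z a * (((φ' - φ) / (φ * normSq z) : ℂ) * conj (z a)) =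
      ((φ' - φ) / (φ * normSq z) : ℂ) * (z a * conj (z a)) := fun a => by ring
    simp only [dotProduct, this, ← Finset.mul_sum, ← ofReal_normSq]
    field_simp
  rw [h1, Matrix.det_smul, det_one_add_vecMulVec, h2, Fintype.card_fin]
  obtain ⟨k, -⟩ := Function.ne_iff.1 hz
  have hn : n = n - 1 + 1 := by have := k.pos; omega
  have h3 : Real.exp (-(n * Real.log (normSq z))) = (normSq z ^ n)⁻¹ := by
    rw [Real.exp_neg, Real.exp_nat_mul, Real.exp_log (normSq_pos hz)]
  rw [h3]
  push_cast
  rw [div_pow]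
  have h4 : (φ : ℂ) ^ n = φ ^ (n - 1) * φ := by conv_lhs => rw [hn, pow_succ]
  rw [h4]
  field_simp
  ring

/-! ### Changes of coordinates -/

theorem contDiff_mulVec_update (A : Matrix.unitaryGroup (Fin n) ℂ) (i k : Fin n) :
    ContDiff ℂ ∞ fun p : Fin n → ℂ => A.1.mulVec (Function.update p i 1) k := by
  simp only [Matrix.mulVec, dotProduct]
  refine ContDiff.sum fun l _ => contDiff_const.mul ?_
  by_cases h : l = i
  · subst h; simpa using contDiff_const
  · simpa [h] using contDiff_apply ℂ ℂ l

/-- The part of the chart over `U_i` that `A` carries to the part of `X_m` over `U_j`. -/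
def overlap (m : ℕ) (A : Matrix.unitaryGroup (Fin n) ℂ) (i j : Fin n) : Set (Fin n → ℂ) :=
  {p | (rotate A (param i p) : X n m) ∈ domain j}

theorem isOpen_overlap (A : Matrix.unitaryGroup (Fin n) ℂ) (i j : Fin n) :
    IsOpen (overlap m A i j) :=
  isOpen_ne.preimage (contDiff_mulVec_update A i j).continuous

/-- The action of `A` in the coordinates over `U_i` and `U_j`. -/
def transition (m : ℕ) (A : Matrix.unitaryGroup (Fin n) ℂ) (i j : Fin n) (p : Fin n → ℂ) :
    Fin n → ℂ := coord j (rotate A (param i p) : X n m)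

theorem contDiffAt_transition (A : Matrix.unitaryGroup (Fin n) ℂ) (i j : Fin n)
    {p : Fin n → ℂ} (hp : p ∈ overlap m A i j) : ContDiffAt ℂ ∞ (transition m A i j) p := by
  change ContDiffAt ℂ ∞ (fun (p : Fin n → ℂ) k =>
    if k = j then A.1.mulVec (Function.update p i 1) j ^ m * p i
      else A.1.mulVec (Function.update p i 1) k / A.1.mulVec (Function.update p i 1) j) p
  refine contDiffAt_pi.2 fun k => ?_
  by_cases h : k = j
  · simp only [h, if_true]
    exact (((contDiff_mulVec_update A i j).pow m).mul (contDiff_apply ℂ ℂ i)).contDiffAt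
  · simp only [h, if_false]
    exact (contDiff_mulVec_update A i k).contDiffAt.div
      (contDiff_mulVec_update A i j).contDiffAt hp

theorem fibreNormSq_transition (A : Matrix.unitaryGroup (Fin n) ℂ) (i j : Fin n)
    {p : Fin n → ℂ} (hp : p ∈ overlap m A i j) :
    fibreNormSq (param j (transition m A i j p) : X n m) =
      fibreNormSq (param i p : X n m) := by
  rw [transition, param_coord hp, fibreNormSq_rotate]

theorem transition_ne_zero (A : Matrix.unitaryGroup (Fin n) ℂ) (i j : Fin n)
    {p : Fin n → ℂ} (hp : p ∈ overlap m A i j) (h : p i ≠ 0) : transition m A i j p j ≠ 0 := by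
  rwa [← fibreNormSq_param_ne_zero (m := m), fibreNormSq_transition A i j hp,
    fibreNormSq_param_ne_zero]

theorem contDiffAt_potential {u : ℝ → ℝ} (hu : ContDiff ℝ ∞ u) (j : Fin n) {p : Fin n → ℂ}
    (hp : p j ≠ 0) : ContDiffAt ℝ ∞ (fun q => (u (logCoord m j q) : ℂ)) p :=
  Complex.ofRealCLM.contDiff.contDiffAt.comp p
    (hu.contDiffAt.comp p (contDiffAt_logCoord j hp))

/-- The function s, hence t, is invariant under U(n), and the action is holomorphic in the charts.
The case A = 1 is a change of chart, so this covers compatibility and symmetry together. -/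
theorem ddbar_transition {u : ℝ → ℝ} (hu : ContDiff ℝ ∞ u)
    (A : Matrix.unitaryGroup (Fin n) ℂ) (i j : Fin n)
    {p : Fin n → ℂ} (hp : p ∈ overlap m A i j) (h : p i ≠ 0) :
    ddbar (fun q => (u (logCoord m i q) : ℂ)) p =
      pullback (transition m A i j) (ddbar fun q => (u (logCoord m j q) : ℂ)) p := by
  rw [← ddbar_comp (contDiffAt_potential hu j (transition_ne_zero A i j hp h))
    (contDiffAt_transition A i j hp)]
  refine ddbar_congr ?_
  filter_upwards [(isOpen_overlap A i j).mem_nhds hp] with q hq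
  rw [logCoord, logCoord, fibreNormSq_transition A i j hq]

/-! ### Extension by continuity across the zero section -/

theorem continuousOn_jac {τ : (Fin n → ℂ) → (Fin n → ℂ)} {W : Set (Fin n → ℂ)}
    (hτ : ∀ p ∈ W, ContDiffAt ℂ ∞ τ p) : ContinuousOn (jac τ) W := by
  intro p hp
  refine ContinuousAt.continuousWithinAt ?_
  refine continuousAt_pi.2 fun k => continuousAt_pi.2 fun a => ?_
  exact (differentiableAt_jac (hτ p hp) k a).continuousAt

theorem dense_ne_zero (j : Fin n) : Dense {p : Fin n → ℂ | p j ≠ 0} :=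
  Dense.preimage (dense_compl_singleton (0 : ℂ)) (isOpenMap_eval j)

/-- The zero section has dense complement in the chart. Identities proved where t is defined thus
extend to all of X_m once both sides are continuous. -/
theorem eqOn_of_dense {Y : Type*} [TopologicalSpace Y] [T2Space Y] {W : Set (Fin n → ℂ)}
    (hW : IsOpen W) (j : Fin n) {F G : (Fin n → ℂ) → Y} (hF : ContinuousOn F W)
    (hG : ContinuousOn G W) (h : ∀ p ∈ W, p j ≠ 0 → F p = G p) : Set.EqOn F G W := by
  have h1 : Set.EqOn F G (W ∩ {p | p j ≠ 0}) := fun p hp => h p hp.1 hp.2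
  refine h1.of_subset_closure hF hG Set.inter_subset_left ?_
  have := hW.inter_closure (t := {p : Fin n → ℂ | p j ≠ 0})
  rwa [(dense_ne_zero j).closure_eq, Set.inter_univ] at this

/-! ### The parametrization by `ℂⁿ ∖ {0}` -/

theorem ne_zero_of_apply {z : Fin n → ℂ} {j : Fin n} (hz : z j ≠ 0) : z ≠ 0 := fun h =>
  hz (by simp [h])

theorem param_coverCoord {z : Fin n → ℂ} {j : Fin n} (hz : z j ≠ 0) :
    param j (coverCoord m j z) = cover m z (ne_zero_of_apply hz) := by
  have h : cover m z (ne_zero_of_apply hz) ∈ domain j := hz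
  rw [← coord_cover j z (ne_zero_of_apply hz), param_coord h]

theorem logCoord_coverCoord (hm : m ≠ 0) {z : Fin n → ℂ} {j : Fin n} (hz : z j ≠ 0) :
    logCoord m j (coverCoord m j z) = Real.log (normSq z) := by
  have : (m : ℝ) ≠ 0 := Nat.cast_ne_zero.2 hm
  rw [logCoord, param_coverCoord hz, fibreNormSq_cover, Real.log_pow, mul_div_cancel_left₀ _ this]

theorem coverCoord_apply_self (j : Fin n) (z : Fin n → ℂ) : coverCoord m j z j = z j ^ m := by
  simp [coverCoord]

theorem contDiffAt_coverCoord {z : Fin n → ℂ} {j : Fin n} (hz : z j ≠ 0) :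
    ContDiffAt ℂ ∞ (coverCoord m j) z := by
  refine contDiffAt_pi.2 fun k => ?_
  by_cases h : k = j
  · simp only [coverCoord, h, if_true]
    exact ((contDiff_apply ℂ ℂ j).pow m).contDiffAt
  · simp only [coverCoord, h, if_false]
    exact (contDiff_apply ℂ ℂ k).contDiffAt.div (contDiff_apply ℂ ℂ j).contDiffAt hz

theorem normSq_eq_coverCoord {z : Fin n → ℂ} {j : Fin n} (hz : z j ≠ 0) :
    normSq z = ‖z j‖ ^ 2 * baseNormSq j (coverCoord m j z) := by
  rw [baseNormSq, ← normSq_smul]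
  congr 1
  funext k
  by_cases h : k = j
  · subst h; simp
  · simp [h, coverCoord, mul_div_cancel₀ _ hz]

theorem radialForm_eq_pullback {u : ℝ → ℝ} (hu : ContDiff ℝ ∞ u) (hm : m ≠ 0)
    {z : Fin n → ℂ} {j : Fin n} (hz : z j ≠ 0) :
    radialForm u z =
      pullback (coverCoord m j) (ddbar fun q => (u (logCoord m j q) : ℂ)) z := by
  have h0 : coverCoord m j z j ≠ 0 := by
    rw [coverCoord_apply_self]; exact pow_ne_zero m hz
  rw [← ddbar_comp (contDiffAt_potential hu j h0) (contDiffAt_coverCoord hz)]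
  refine ddbar_congr ?_
  filter_upwards [(continuous_apply j).continuousAt.eventually_ne hz] with q hq
  rw [logCoord_coverCoord hm hq]

/-- Factored as diagonal times unipotent: the rank-one term has no entry in slot j, so only the
diagonal contributes to the determinant. -/
theorem jac_coverCoord {z : Fin n → ℂ} {j : Fin n} (hz : z j ≠ 0) :
    jac (coverCoord m j) z =
      Matrix.diagonal (fun k => if k = j then m * z j ^ (m - 1) else (z j)⁻¹) *
        (1 + Matrix.vecMulVec (fun k => if k = j then 0 else -(z k / z j)) (Pi.single j 1)) := by
  ext k a
  have h1 : jac (coverCoord m j) z k a =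
      fderiv ℂ (fun q => coverCoord m j q k) z (Pi.single a 1) := by
    rw [jac, Matrix.of_apply, fderiv_apply ((contDiffAt_coverCoord hz).differentiableAt (by simp))]
    rfl
  rw [h1, Matrix.diagonal_mul, Matrix.add_apply, Matrix.vecMulVec_apply, Matrix.one_apply]
  have hj : ∀ l, HasFDerivAt (fun q : Fin n → ℂ => q l)
    (ContinuousLinearMap.proj (R := ℂ) (φ := fun _ : Fin n => ℂ) l) z := fun l => hasFDerivAt_apply l z
  by_cases h : k = j
  · subst h
    have h2 : HasFDerivAt (𝕜 := ℂ) (fun q : Fin n → ℂ => q k ^ m) _ z := (hj k).pow m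
    simp only [coverCoord, if_true]
    rw [h2.fderiv]
    simp [Pi.single_apply, eq_comm]
  · have h3 := (hasDerivAt_inv hz).comp_hasFDerivAt z (hj j)
    have h2 := (hj k).mul h3
    simp only [coverCoord, h, if_false, div_eq_mul_inv]
    rw [show (fun q : Fin n → ℂ => q k * (q j)⁻¹) =
      (fun q => q k) * ((fun y : ℂ => y⁻¹) ∘ fun q : Fin n → ℂ => q j) from rfl, h2.fderiv]
    by_cases ha : a = k
    · subst ha
      have h' : ¬ j = a := fun h' => h h'.symm
      simp [h, h']
    · have ha' : ¬ k = a := fun h' => ha h'.symm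
      by_cases hb : a = j
      · subst hb
        simp [h]
        field_simp
      · have hb' : ¬ j = a := fun h' => hb h'.symm
        simp [ha', hb, hb']

theorem det_jac_coverCoord {z : Fin n → ℂ} {j : Fin n} (hz : z j ≠ 0) :
    (jac (coverCoord m j) z).det = m * z j ^ (m - 1) * (z j)⁻¹ ^ (n - 1) := by
  rw [jac_coverCoord hz, Matrix.det_mul, Matrix.det_diagonal, det_one_add_vecMulVec,
    ← Finset.mul_prod_erase _ _ (Finset.mem_univ j)]
  have h : ∀ k ∈ Finset.univ.erase j,
      (if k = j then m * z j ^ (m - 1) else (z j)⁻¹) = (z j)⁻¹ := fun k hk => by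
    simp [Finset.ne_of_mem_erase hk]
  rw [Finset.prod_congr rfl h]
  simp [Finset.card_erase_of_mem]

theorem det_pullback (τ : (Fin n → ℂ) → (Fin n → ℂ))
    (h : (Fin n → ℂ) → Matrix (Fin n) (Fin n) ℂ) (p : Fin n → ℂ) :
    (pullback τ h p).det = ((‖(jac τ p).det‖ ^ 2 : ℝ) : ℂ) * (h (τ p)).det := by
  have h1 : ((jac τ p).map star).det = conj (jac τ p).det := by
    simpa using (RingHom.map_det (starRingEnd ℂ) (jac τ p)).symm
  rw [pullback, Matrix.det_mul, Matrix.det_mul, Matrix.det_transpose, h1,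
    ← Complex.normSq_eq_norm_sq, ← Complex.mul_conj]
  ring

theorem eq_of_pullback_eq {τ : (Fin n → ℂ) → (Fin n → ℂ)}
    {h h' : (Fin n → ℂ) → Matrix (Fin n) (Fin n) ℂ} {p : Fin n → ℂ}
    (hJ : (jac τ p).det ≠ 0) (e : pullback τ h p = pullback τ h' p) : h (τ p) = h' (τ p) := by
  have h1 : ((jac τ p).map star).det = conj (jac τ p).det := by
    simpa using (RingHom.map_det (starRingEnd ℂ) (jac τ p)).symm
  have u1 : IsUnit ((jac τ p).map star) := by
    rw [Matrix.isUnit_iff_isUnit_det, h1]; simpa using hJ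
  have u2 : IsUnit (jac τ p).transpose := by
    rw [Matrix.isUnit_iff_isUnit_det, Matrix.det_transpose]; exact hJ.isUnit
  exact u2.mul_left_cancel (u1.mul_right_cancel e)

theorem exists_coverCoord_eq (hm : m ≠ 0) {j : Fin n} {p : Fin n → ℂ} (hp : p j ≠ 0) :
    ∃ z : Fin n → ℂ, z j ≠ 0 ∧ coverCoord m j z = p := by
  obtain ⟨c, hc⟩ := IsAlgClosed.exists_pow_nat_eq (p j) (Nat.pos_of_ne_zero hm)
  have hc0 : c ≠ 0 := by
    rintro rfl
    rw [zero_pow hm] at hc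
    exact hp hc.symm
  refine ⟨c • Function.update p j 1, by simpa using hc0, ?_⟩
  funext k
  by_cases h : k = j
  · subst h; simp [coverCoord, hc]
  · simp [coverCoord, h, hc0]

/-- Divide the determinant on ℂⁿ ∖ {0} by |det J|² = m²|z_j|^{2(m-n)}. With |z|² = |z_j|²N, the
remaining power |z_j|^{2m} is |y|². -/
theorem det_ddbar_potential {u : ℝ → ℝ} (hu : ContDiff ℝ ∞ u) (hm : m ≠ 0) {j : Fin n}
    {p : Fin n → ℂ} (hp : p j ≠ 0) (hφ : deriv u (logCoord m j p) ≠ 0) :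
    (ddbar (fun q => (u (logCoord m j q) : ℂ)) p).det =
      ((deriv u (logCoord m j p) ^ (n - 1) * deriv (deriv u) (logCoord m j p) /
        (baseNormSq j p ^ n * m ^ 2 * ‖p j‖ ^ 2) : ℝ) : ℂ) := by
  obtain ⟨z, hz, rfl⟩ := exists_coverCoord_eq hm hp
  rw [logCoord_coverCoord hm hz] at hφ ⊢
  have h1 := det_radialForm hu (ne_zero_of_apply hz) hφ
  rw [radialForm_eq_pullback hu hm hz, det_pullback, det_jac_coverCoord hz] at h1
  have hm' : (m : ℝ) ≠ 0 := Nat.cast_ne_zero.2 hm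
  have hzn : ‖z j‖ ≠ 0 := norm_ne_zero_iff.2 hz
  have hN := (baseNormSq_pos j (coverCoord m j z)).ne'
  have h2 : (‖(m : ℂ) * z j ^ (m - 1) * (z j)⁻¹ ^ (n - 1)‖ ^ 2 : ℝ) ≠ 0 := by
    simp [hm, hz]
  have h3 := mul_left_cancel₀ (Complex.ofReal_ne_zero.2 h2) (h1.trans (b := _) (c :=
    ((‖(m : ℂ) * z j ^ (m - 1) * (z j)⁻¹ ^ (n - 1)‖ ^ 2 : ℝ) : ℂ) *
      ((deriv u (Real.log (normSq z)) ^ (n - 1) * deriv (deriv u) (Real.log (normSq z)) /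
        (baseNormSq j (coverCoord m j z) ^ n * m ^ 2 * ‖coverCoord m j z j‖ ^ 2) : ℝ) : ℂ)) ?_)
  · exact h3
  · rw [← Complex.ofReal_mul]
    congr 1
    rw [Real.exp_neg, Real.exp_nat_mul, Real.exp_log (normSq_pos (ne_zero_of_apply hz)),
      normSq_eq_coverCoord (m := m) hz, coverCoord_apply_self]
    obtain ⟨m, rfl⟩ := Nat.exists_eq_succ_of_ne_zero hm
    obtain ⟨n, rfl⟩ := Nat.exists_eq_succ_of_ne_zero j.pos.ne'
    simp only [norm_mul, norm_pow, norm_inv, Nat.succ_sub_one, Nat.succ_eq_add_one,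
      Complex.norm_natCast, inv_pow]
    field_simp
    ring

/-! ### The profile of the soliton -/

/-- The right-hand side of the differential equation `Φ' = 1 / (n Φⁿ⁻¹ e^Φ)`. -/
def profileRate (n : ℕ) (x : ℝ) : ℝ := (n * x ^ (n - 1) * Real.exp x)⁻¹

/-- `Φ` solves `n Φⁿ⁻¹ e^Φ Φ' = 1` with `Φ 0 = a`, near the half-line `[0, ∞)`. -/
structure IsProfile (n : ℕ) (a : ℝ) (Φ : ℝ → ℝ) : Prop where
  map_zero : Φ 0 = a
  le_map : ∀ s, 0 ≤ s → a ≤ Φ s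
  contDiffAt : ∀ s, 0 ≤ s → ContDiffAt ℝ ∞ Φ s
  eventually_hasDerivAt : ∀ s, 0 ≤ s → ∀ᶠ r in 𝓝 s, 0 < Φ r ∧
    HasDerivAt Φ (profileRate n (Φ r)) r

/-- Separation of variables: Φ is the inverse of the primitive G of w based at a. The lower bound on
w makes G a bijection of ℝ, so the solution is global. -/
theorem exists_leftInverse_of_deriv {w : ℝ → ℝ} (hw : Continuous w) {c : ℝ} (hc : 0 < c)
    (hcw : ∀ x, c ≤ w x) (a : ℝ) :
    ∃ Φ : ℝ → ℝ, Φ 0 = a ∧ Monotone Φ ∧ Continuous Φ ∧ ∀ s, HasDerivAt Φ (w (Φ s))⁻¹ s := by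
  set G : ℝ → ℝ := fun x => ∫ r in a..x, w r with hG
  have hd : ∀ x, HasDerivAt G (w x) x := fun x =>
    intervalIntegral.integral_hasDerivAt_right (hw.intervalIntegrable _ _)
      hw.aestronglyMeasurable.stronglyMeasurableAtFilter hw.continuousAt
  have hmono : StrictMono G := strictMono_of_deriv_pos fun x => by
    rw [(hd x).deriv]; exact hc.trans_le (hcw x)
  have hcont : Continuous G := continuous_iff_continuousAt.2 fun x => (hd x).continuousAt
  -- Comparison with the line of slope c shows that G is unbounded in both directions.
  have hlin : Monotone fun x => G x - c * x := by
    have hd' : ∀ x, HasDerivAt (fun x => G x - c * x) (w x - c * 1) x := fun x =>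
      (hd x).sub ((hasDerivAt_id x).const_mul c)
    refine monotone_of_deriv_nonneg (fun x => (hd' x).differentiableAt) fun x => ?_
    rw [(hd' x).deriv]
    linarith [hcw x]
  have hsurj : Function.Surjective G := by
    refine hcont.surjective ?_ ?_
    · refine Filter.tendsto_atTop_mono' _ (f₁ := fun x => c * x + (G 0 - c * 0)) ?_ ?_
      · filter_upwards [Filter.eventually_ge_atTop 0] with x hx
        linarith [hlin hx]
      · exact Filter.tendsto_atTop_add_const_right _ _ (Filter.tendsto_id.const_mul_atTop hc)
    · refine Filter.tendsto_atBot_mono' _ (f₁ := fun x => c * x + (G 0 - c * 0)) ?_ ?_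
      · filter_upwards [Filter.eventually_le_atBot 0] with x hx
        linarith [hlin hx]
      · exact Filter.tendsto_atBot_add_const_right _ _ (Filter.tendsto_id.const_mul_atBot hc)
  let e := StrictMono.orderIsoOfSurjective G hmono hsurj
  have he : ∀ s, G (e.symm s) = s := fun s => e.apply_symm_apply s
  refine ⟨e.symm, ?_, e.symm.monotone, e.symm.continuous, fun s => ?_⟩
  · apply hmono.injective
    rw [he]
    simp [hG]
  · exact HasDerivAt.of_local_left_inverse e.symm.continuous.continuousAt (hd _)
      (hc.trans_le (hcw _)).ne' (.of_forall he)

/-- Bootstrapping: if Φ is C^k, then so is Φ' = R∘Φ, hence Φ is C^{k+1}. -/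
theorem contDiffOn_infty_of_hasDerivAt {Φ R : ℝ → ℝ} {O : Set ℝ} (hO : IsOpen O)
    (hΦ : ∀ s ∈ O, HasDerivAt Φ (R (Φ s)) s) (hR : ∀ s ∈ O, ContDiffAt ℝ ∞ R (Φ s)) :
    ContDiffOn ℝ ∞ Φ O := by
  have hd : DifferentiableOn ℝ Φ O := fun s hs => (hΦ s hs).differentiableAt.differentiableWithinAt
  refine contDiffOn_infty.2 fun k => ?_
  induction k with
  | zero => exact contDiffOn_zero.2 hd.continuousOn
  | succ k ih =>
    push_cast
    refine (contDiffOn_succ_iff_deriv_of_isOpen hO).2 ⟨hd, by simp, ?_⟩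
    have h1 : ContDiffOn ℝ k (fun s => R (Φ s)) O := fun s hs =>
      ((hR s hs).of_le (by exact_mod_cast le_top)).comp_contDiffWithinAt s (ih s hs)
    exact h1.congr fun s hs => (hΦ s hs).deriv

theorem contDiffAt_profileRate {n : ℕ} (hn : n ≠ 0) {x : ℝ} (hx : 0 < x) :
    ContDiffAt ℝ ∞ (profileRate n) x := by
  have : (0 : ℝ) < n := by positivity
  refine ContDiffAt.inv ?_ (by positivity)
  exact (contDiffAt_const.mul (contDiffAt_id.pow _)).mul Real.contDiff_exp.contDiffAt

theorem exists_isProfile {n : ℕ} (hn : n ≠ 0) {a : ℝ} (ha : 0 < a) : ∃ Φ, IsProfile n a Φ := by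
  have hn' : (0 : ℝ) < n := by positivity
  -- Cutting off at a/2 keeps the rate positive and bounded below on all of ℝ. Where Φ > a/2, which
  -- is an open set containing [0, ∞), the cut-off is inactive.
  obtain ⟨Φ, h0, hmono, hcont, hd⟩ := exists_leftInverse_of_deriv
    (w := fun r => n * max r (a / 2) ^ (n - 1) * Real.exp (max r (a / 2)))
    (by fun_prop) (c := n * (a / 2) ^ (n - 1) * Real.exp (a / 2)) (by positivity)
    (fun x => by gcongr <;> exact le_max_right _ _) a
  have hO : IsOpen {s | a / 2 < Φ s} := isOpen_lt continuous_const hcont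
  have hd' : ∀ s ∈ {s | a / 2 < Φ s}, HasDerivAt Φ (profileRate n (Φ s)) s := fun s hs => by
    have := hd s
    rwa [max_eq_left (le_of_lt hs)] at this
  have hge : ∀ s, 0 ≤ s → a ≤ Φ s := fun s hs => h0 ▸ hmono hs
  have hmem : ∀ s, 0 ≤ s → {s | a / 2 < Φ s} ∈ 𝓝 s := fun s hs =>
    hO.mem_nhds (lt_of_lt_of_le (by linarith) (hge s hs))
  refine ⟨Φ, h0, hge, fun s hs => ?_, fun s hs => ?_⟩
  · exact (contDiffOn_infty_of_hasDerivAt hO hd' fun s hs => contDiffAt_profileRate hn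
      (lt_trans (by linarith) hs)).contDiffAt (hmem s hs)
  · filter_upwards [hmem s hs] with r hr using ⟨lt_trans (by linarith) hr, hd' r hr⟩

namespace IsProfile

variable {n : ℕ} {a : ℝ} {Φ : ℝ → ℝ}

theorem pos (h : IsProfile n a Φ) {s : ℝ} (hs : 0 ≤ s) : 0 < Φ s :=
  (h.eventually_hasDerivAt s hs).self_of_nhds.1

theorem hasDerivAt (h : IsProfile n a Φ) {s : ℝ} (hs : 0 ≤ s) :
    HasDerivAt Φ (profileRate n (Φ s)) s :=
  (h.eventually_hasDerivAt s hs).self_of_nhds.2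

theorem deriv_eq (h : IsProfile n a Φ) {s : ℝ} (hs : 0 ≤ s) :
    deriv Φ s = profileRate n (Φ s) := (h.hasDerivAt hs).deriv

theorem contDiffAt_deriv (h : IsProfile n a Φ) {s : ℝ} (hs : 0 ≤ s) :
    ContDiffAt ℝ ∞ (deriv Φ) s :=
  ((h.contDiffAt s hs).fderiv_right (m := ∞) (by simp)).clm_apply contDiffAt_const

end IsProfile

theorem profileRate_pos {n : ℕ} (hn : n ≠ 0) {x : ℝ} (hx : 0 < x) : 0 < profileRate n x := by
  have : (0 : ℝ) < n := by positivity
  unfold profileRate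
  positivity

theorem IsProfile.deriv_pos {n : ℕ} {a : ℝ} {Φ : ℝ → ℝ} (h : IsProfile n a Φ) (hn : n ≠ 0) {s : ℝ}
    (hs : 0 ≤ s) : 0 < deriv Φ s := by
  rw [h.deriv_eq hs]; exact profileRate_pos hn (h.pos hs)

/-- The potential of the soliton with profile `Φ`. -/
def potential (n : ℕ) (Φ : ℝ → ℝ) (t : ℝ) : ℝ := ∫ r in (0 : ℝ)..t, Φ (Real.exp (n * r))

theorem hasDerivAt_log_profileRate {n : ℕ} (hn : n ≠ 0) {x : ℝ} (hx : 0 < x) :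
    HasDerivAt (fun x => Real.log (profileRate n x)) (-(((n - 1 : ℕ) : ℝ) / x + 1)) x := by
  have hn' : (0 : ℝ) < n := by positivity
  have h1 : HasDerivAt (fun x => -(Real.log n + ((n - 1 : ℕ) : ℝ) * Real.log x + x))
      (-((0 + ((n - 1 : ℕ) : ℝ) * x⁻¹) + 1)) x :=
    ((((hasDerivAt_const x (Real.log n)).add
      ((Real.hasDerivAt_log hx.ne').const_mul _)).add (hasDerivAt_id x))).neg
  refine (h1.congr_of_eventuallyEq ?_).congr_deriv (by ring)
  filter_upwards [eventually_gt_nhds hx] with y hy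
  rw [profileRate, Real.log_inv, Real.log_mul (by positivity) (by positivity),
    Real.log_mul (by positivity) (by positivity), Real.log_pow, Real.log_exp]

theorem hasDerivAt_profileRate {n : ℕ} (hn : n ≠ 0) {x : ℝ} (hx : 0 < x) :
    HasDerivAt (profileRate n) (-(((n - 1 : ℕ) : ℝ) / x + 1) * profileRate n x) x := by
  have h1 := (hasDerivAt_log_profileRate hn hx).exp
  rw [Real.exp_log (profileRate_pos hn hx), mul_comm] at h1
  refine h1.congr_of_eventuallyEq ?_
  filter_upwards [eventually_gt_nhds hx] with y hy
  rw [Real.exp_log (profileRate_pos hn hy)]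

/-! ### Estimates for the profile, and the potential built from it -/

namespace IsProfile

variable {n : ℕ} {a : ℝ} {Φ : ℝ → ℝ}

/-- The key inequality. Its difference of sides is, up to a positive factor, (log Φ')' + s(log
Φ')'', so it is what the fibre curvature requires; it also yields sΦ' ≤ 1 for completeness. -/
theorem mul_rate_lt (h : IsProfile n a Φ) (hn : n ≠ 0) {s : ℝ} (hs : 0 ≤ s) :
    s * profileRate n (Φ s) * (Φ s ^ 2 + 2 * (n - 1 : ℕ) * Φ s + (n - 1 : ℕ) ^ 2 + (n - 1 : ℕ)) <
      ((n - 1 : ℕ) + Φ s) * Φ s := by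
  set M : ℝ := ((n - 1 : ℕ) : ℝ) with hM
  have hM0 : 0 ≤ M := Nat.cast_nonneg _
  have hD : ∀ x : ℝ, 0 < x → 0 < x ^ 2 + 2 * M * x + M ^ 2 + M := fun x hx => by positivity
  -- The claim solved for s is s < Q(Φ(s)). This holds because Q(Φ(s)) - s is positive at s = 0 and
  -- nondecreasing.
  let Q : ℝ → ℝ := fun x => (M + x) * x / (profileRate n x * (x ^ 2 + 2 * M * x + M ^ 2 + M))
  have hQ : ∀ x, 0 < x → ∃ Q', HasDerivAt Q Q' x ∧ 1 ≤ Q' * profileRate n x := fun x hx => by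
    have hr := profileRate_pos hn hx
    have hDx := hD x hx
    have h1 : HasDerivAt (fun x => (M + x) * x) (1 * x + (M + x) * 1) x :=
      ((hasDerivAt_id x).const_add M).mul (hasDerivAt_id x)
    have h2 : HasDerivAt (fun x => x ^ 2 + 2 * M * x + M ^ 2 + M)
        ((2 : ℕ) * x ^ (2 - 1) * 1 + 2 * M * 1) x :=
      (((((hasDerivAt_id x).pow 2).add ((hasDerivAt_id x).const_mul (2 * M))).add_const
        (M ^ 2)).add_const M)
    refine ⟨_, h1.div ((hasDerivAt_profileRate hn hx).mul h2) (by positivity), ?_⟩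
    rw [div_mul_eq_mul_div, one_le_div (by positivity), ← sub_nonneg]
    -- With D = (x + M)² + M and r' = -(M/x + 1)r, numerator minus denominator of Q'r - 1 collapses
    -- to 2Mx r².
    have : 0 ≤ profileRate n x ^ 2 * (2 * x * M) := by positivity
    refine this.trans_eq ?_
    rw [← hM]
    field_simp
    push_cast
    ring
  have hmono : MonotoneOn (fun s => Q (Φ s) - s) (Set.Ici 0) := by
    have hd : ∀ s, 0 ≤ s → ∃ Q', HasDerivAt (fun s => Q (Φ s) - s) Q' s ∧ 0 ≤ Q' := fun s hs => by
      obtain ⟨Q', h1, h2⟩ := hQ (Φ s) (h.pos hs)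
      exact ⟨_, (h1.comp s (h.hasDerivAt hs)).sub (hasDerivAt_id s), by linarith⟩
    refine monotoneOn_of_deriv_nonneg (convex_Ici 0) ?_ ?_ ?_
    · intro s hs
      obtain ⟨_, h1, -⟩ := hd s hs
      exact h1.continuousAt.continuousWithinAt
    · intro s hs
      obtain ⟨_, h1, -⟩ := hd s (interior_subset hs)
      exact h1.differentiableAt.differentiableWithinAt
    · intro s hs
      obtain ⟨_, h1, h2⟩ := hd s (interior_subset hs)
      rwa [h1.deriv]
  have hx := h.pos hs
  have hx0 := h.pos le_rfl
  have hr := profileRate_pos hn hx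
  have hr0 := profileRate_pos hn hx0
  have h0 : 0 < Q (Φ 0) := by
    have := hD _ hx0
    change 0 < _ / _
    positivity
  have h1 : Q (Φ 0) - 0 ≤ Q (Φ s) - s := hmono (Set.mem_Ici.2 le_rfl) (Set.mem_Ici.2 hs) hs
  have h2 : s < Q (Φ s) := by linarith
  have hDx := hD _ hx
  have h3 : s < (M + Φ s) * Φ s / (profileRate n (Φ s) * _) := h2
  rw [lt_div_iff₀ (by positivity)] at h3
  linarith

/-- In `mul_rate_lt` the quadratic factor on the left dominates the right-hand side (M + Φ)Φ. -/
theorem mul_deriv_le_one (h : IsProfile n a Φ) (hn : n ≠ 0) {s : ℝ} (hs : 0 ≤ s) :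
    s * deriv Φ s ≤ 1 := by
  rw [h.deriv_eq hs]
  have h1 := h.mul_rate_lt hn hs
  set M : ℝ := ((n - 1 : ℕ) : ℝ) with hM
  have hM0 : 0 ≤ M := Nat.cast_nonneg _
  have hx := h.pos hs
  by_contra! hc
  have h2 : (M + Φ s) * Φ s ≤ Φ s ^ 2 + 2 * M * Φ s + M ^ 2 + M := by nlinarith
  have h3 : 0 < Φ s ^ 2 + 2 * M * Φ s + M ^ 2 + M := by positivity
  nlinarith

/-- Since 1/Φ' = nΦ^{n-1}e^Φ, the bound sΦ' ≤ 1 bounds s in terms of Φ: sublevel sets of Φ(s) are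
bounded in s. -/
theorem le_of_map_le (h : IsProfile n a Φ) (hn : n ≠ 0) {s C : ℝ} (hs : 0 ≤ s) (hC : Φ s ≤ C) :
    s ≤ n * C ^ (n - 1) * Real.exp C := by
  have h1 := h.mul_deriv_le_one hn hs
  have hx := h.pos hs
  have hn' : (0 : ℝ) < n := by positivity
  rw [h.deriv_eq hs, profileRate, ← div_eq_mul_inv, div_le_one (by positivity)] at h1
  have hC0 := hx.trans_le hC
  refine h1.trans ?_
  gcongr

theorem contDiffAt_log_deriv (h : IsProfile n a Φ) (hn : n ≠ 0) {s : ℝ} (hs : 0 ≤ s) :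
    ContDiffAt ℝ ∞ (fun r => Real.log (deriv Φ r)) s :=
  (h.contDiffAt_deriv hs).log (h.deriv_pos hn hs).ne'

/-- For v(y) = log Φ'(|y|²) this quantity is ∂_y∂_ȳ v. Expressed through Φ and the rate, it is a
positive multiple of the defect in `mul_rate_lt`. -/
theorem deriv_log_deriv_neg (h : IsProfile n a Φ) (hn : n ≠ 0) {s : ℝ} (hs : 0 ≤ s) :
    deriv (fun r => Real.log (deriv Φ r)) s +
      s * deriv (deriv fun r => Real.log (deriv Φ r)) s < 0 := by
  have hlt := h.mul_rate_lt hn hs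
  set M : ℝ := ((n - 1 : ℕ) : ℝ) with hM
  have hM0 : 0 ≤ M := Nat.cast_nonneg _
  have h1 : ∀ᶠ r in 𝓝 s, deriv (fun r => Real.log (deriv Φ r)) r =
      -(M / Φ r + 1) * profileRate n (Φ r) := by
    filter_upwards [(h.eventually_hasDerivAt s hs).eventually_nhds] with r hr
    have e : (fun r => Real.log (deriv Φ r)) =ᶠ[𝓝 r] fun r => Real.log (profileRate n (Φ r)) := by
      filter_upwards [hr] with q hq
      rw [hq.2.deriv]
    rw [e.deriv_eq]
    exact ((hasDerivAt_log_profileRate hn hr.self_of_nhds.1).comp r hr.self_of_nhds.2).deriv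
  have hx := h.pos hs
  have hr := profileRate_pos hn hx
  have h2 : HasDerivAt (fun x => -(M / x + 1) * profileRate n x)
      (-(-(M / Φ s ^ 2)) * profileRate n (Φ s) +
        -(M / Φ s + 1) * (-(M / Φ s + 1) * profileRate n (Φ s))) (Φ s) := by
    have h3 : HasDerivAt (fun x => -(M / x + 1)) (-(-(M / Φ s ^ 2))) (Φ s) := by
      have := (((hasDerivAt_inv hx.ne').const_mul M).add_const 1).neg
      exact this.congr_deriv (by ring)
    exact h3.mul (hasDerivAt_profileRate hn hx)
  have h5 : HasDerivAt (fun r => -(M / Φ r + 1) * profileRate n (Φ r)) _ s :=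
    h2.comp s (h.hasDerivAt hs)
  rw [Filter.EventuallyEq.deriv_eq h1, h1.self_of_nhds, h5.deriv]
  generalize profileRate n (Φ s) = r at *
  generalize Φ s = x at *
  have h4 : -(M / x + 1) * r + s * ((-(-(M / x ^ 2)) * r +
        -(M / x + 1) * (-(M / x + 1) * r)) * r) =
      r / x ^ 2 * (s * r * (x ^ 2 + 2 * M * x + M ^ 2 + M) - (M + x) * x) := by
    field_simp
    ring
  rw [h4]
  exact mul_neg_of_pos_of_neg (by positivity) (by linarith)

theorem contDiff_comp_exp (h : IsProfile n a Φ) :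
    ContDiff ℝ ∞ fun t => Φ (Real.exp (n * t)) :=
  contDiff_iff_contDiffAt.2 fun t => (h.contDiffAt _ (Real.exp_pos (n * t)).le).comp t
    (Real.contDiff_exp.comp (contDiff_const.mul contDiff_id)).contDiffAt

theorem hasDerivAt_potential (h : IsProfile n a Φ) (t : ℝ) :
    HasDerivAt (potential n Φ) (Φ (Real.exp (n * t))) t :=
  intervalIntegral.integral_hasDerivAt_right
    (h.contDiff_comp_exp.continuous.intervalIntegrable _ _)
    h.contDiff_comp_exp.continuous.aestronglyMeasurable.stronglyMeasurableAtFilter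
    h.contDiff_comp_exp.continuous.continuousAt

theorem deriv_potential (h : IsProfile n a Φ) :
    deriv (potential n Φ) = fun t => Φ (Real.exp (n * t)) :=
  funext fun t => (h.hasDerivAt_potential t).deriv

theorem deriv_potential_apply (h : IsProfile n a Φ) (t : ℝ) :
    deriv (potential n Φ) t = Φ (Real.exp (n * t)) := (h.hasDerivAt_potential t).deriv

theorem contDiff_potential (h : IsProfile n a Φ) : ContDiff ℝ ∞ (potential n Φ) := by
  rw [contDiff_infty_iff_deriv, h.deriv_potential]
  exact ⟨fun t => (h.hasDerivAt_potential t).differentiableAt, h.contDiff_comp_exp⟩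

theorem deriv_deriv_potential (h : IsProfile n a Φ) (t : ℝ) :
    deriv (deriv (potential n Φ)) t = n * Real.exp (n * t) * deriv Φ (Real.exp (n * t)) := by
  rw [h.deriv_potential, h.deriv_eq (Real.exp_pos _).le]
  have h1 : HasDerivAt (fun t : ℝ => Real.exp (n * t)) _ t :=
    ((hasDerivAt_id t).const_mul (n : ℝ)).exp
  have h2 : HasDerivAt (fun t : ℝ => Φ (Real.exp (n * t))) _ t :=
    (h.hasDerivAt (Real.exp_pos (n * t)).le).comp t h1
  rw [h2.deriv]
  simp only [id]
  ring

theorem tendsto_deriv_potential (h : IsProfile n a Φ) (hn : n ≠ 0) :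
    Filter.Tendsto (deriv (potential n Φ)) Filter.atBot (𝓝 a) := by
  have hn' : (0 : ℝ) < n := by positivity
  rw [h.deriv_potential, ← h.map_zero]
  exact (h.contDiffAt 0 le_rfl).continuousAt.tendsto.comp
    (Real.tendsto_exp_atBot.comp (Filter.tendsto_id.const_mul_atBot hn'))

theorem soliton_equation (h : IsProfile n a Φ) (hn : n ≠ 0) (t : ℝ) :
    deriv (potential n Φ) t ^ (n - 1) * deriv (deriv (potential n Φ)) t *
      Real.exp (deriv (potential n Φ) t) = Real.exp (n * t) := by
  have hx := h.pos (Real.exp_pos (n * t)).le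
  have hn' : (n : ℝ) ≠ 0 := Nat.cast_ne_zero.2 hn
  rw [h.deriv_deriv_potential, h.deriv_potential, h.deriv_eq (Real.exp_pos _).le, profileRate]
  field_simp

end IsProfile

/-! ### The soliton metric on `X_n` -/

/-- The smooth extension `c_a = y ∂_a log |z|²` across the zero section. -/
def radialCovector (j : Fin n) (p : Fin n → ℂ) (a : Fin n) : ℂ :=
  (if a = j then (n : ℂ)⁻¹ else 0) + p j * conj (Function.update p j 0 a) / baseNormSq j p

theorem conj_radialCovector {j : Fin n} {p : Fin n → ℂ} (hp : p j ≠ 0) (a : Fin n) :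
    conj (radialCovector j p a) = conj (p j) * dbarLog n j p a := by
  have hc : conj (p j) ≠ 0 := by simpa using hp
  by_cases h : a = j
  · simp [radialCovector, dbarLog, h]; field_simp
  · simp [radialCovector, dbarLog, h]; ring

/-- The components of the soliton metric with profile `Φ`. -/
def solitonCoeff (Φ : ℝ → ℝ) (j : Fin n) (p : Fin n → ℂ) : Matrix (Fin n) (Fin n) ℂ :=
  Matrix.of fun a b => (Φ (fibreNormSq (param j p : X n n)) : ℂ) * fubiniStudy j p a b +
    ((n * deriv Φ (fibreNormSq (param j p : X n n)) * baseNormSq j p ^ n : ℝ) : ℂ) *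
      (radialCovector j p a * conj (radialCovector j p b))

theorem contDiff_ofReal_baseNormSq (j : Fin n) :
    ContDiff ℝ ∞ fun p : Fin n → ℂ => (baseNormSq j p : ℂ) :=
  Complex.ofRealCLM.contDiff.comp (contDiff_baseNormSq j)

theorem contDiff_update_apply (j k : Fin n) (c : ℂ) :
    ContDiff ℝ ∞ fun p : Fin n → ℂ => Function.update p j c k :=
  contDiff_pi.1 (contDiff_update j c) k

theorem contDiff_conj : ContDiff ℝ ∞ (conj : ℂ → ℂ) :=
  (Complex.conjCLE : ℂ →L[ℝ] ℂ).contDiff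

theorem ofReal_baseNormSq_ne_zero (j : Fin n) (p : Fin n → ℂ) : (baseNormSq j p : ℂ) ≠ 0 :=
  Complex.ofReal_ne_zero.2 (baseNormSq_pos j p).ne'

theorem contDiff_fubiniStudy (j a b : Fin n) :
    ContDiff ℝ ∞ fun p : Fin n → ℂ => fubiniStudy j p a b := by
  have h1 := (contDiff_ofReal_baseNormSq (n := n) j)
  simp only [fubiniStudy, Matrix.of_apply, div_eq_mul_inv]
  refine ContDiff.sub ?_ (((contDiff_conj.comp (contDiff_update_apply j a 0)).mul
    (contDiff_update_apply j b 0)).mul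
      ((h1.pow 2).inv fun p => pow_ne_zero 2 (ofReal_baseNormSq_ne_zero j p)))
  split_ifs
  · exact h1.inv (ofReal_baseNormSq_ne_zero j)
  · exact contDiff_const

theorem contDiff_radialCovector (j a : Fin n) :
    ContDiff ℝ ∞ fun p : Fin n → ℂ => radialCovector j p a := by
  simp only [radialCovector, div_eq_mul_inv]
  exact contDiff_const.add (((contDiff_apply ℝ ℂ j).mul
    (contDiff_conj.comp (contDiff_update_apply j a 0))).mul ((contDiff_ofReal_baseNormSq j).inv
      (ofReal_baseNormSq_ne_zero j)))

theorem fubiniStudy_self_right (j : Fin n) (p : Fin n → ℂ) (a : Fin n) :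
    fubiniStudy j p a j = 0 := by
  simp [fubiniStudy]

/-- The quadratic form of the soliton metric. -/
def solitonQuad (Φ : ℝ → ℝ) (j : Fin n) (p ξ : Fin n → ℂ) : ℝ :=
  Φ (fibreNormSq (param j p : X n n)) * (normSq (Function.update ξ j 0) / baseNormSq j p -
      ‖∑ a, conj (Function.update p j 0 a) * ξ a‖ ^ 2 / baseNormSq j p ^ 2) +
    n * deriv Φ (fibreNormSq (param j p : X n n)) * baseNormSq j p ^ n *
      ‖∑ a, radialCovector j p a * ξ a‖ ^ 2

theorem contDiff_comp_fibreNormSq {Ψ : ℝ → ℝ} (h : ∀ s, 0 ≤ s → ContDiffAt ℝ ∞ Ψ s)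
    (j : Fin n) : ContDiff ℝ ∞ fun p => Ψ (fibreNormSq (param j p : X n m)) :=
  contDiff_iff_contDiffAt.2 fun p =>
    (h _ (fibreNormSq_nonneg (param j p : X n m))).comp p
      (contDiff_fibreNormSq_param j).contDiffAt

theorem contDiff_ofReal_comp_fibreNormSq {Ψ : ℝ → ℝ} (h : ∀ s, 0 ≤ s → ContDiffAt ℝ ∞ Ψ s)
    (j : Fin n) : ContDiff ℝ ∞ fun p => (Ψ (fibreNormSq (param j p : X n m)) : ℂ) :=
  Complex.ofRealCLM.contDiff.comp (contDiff_comp_fibreNormSq h j)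

theorem sum_sum_solitonCoeff (Φ : ℝ → ℝ) (j : Fin n) (p ξ : Fin n → ℂ) :
    ∑ a, ∑ b, solitonCoeff Φ j p a b * ξ a * conj (ξ b) = (solitonQuad Φ j p ξ : ℂ) := by
  have key : ∀ c : Fin n → ℂ, ((‖∑ a, c a * ξ a‖ ^ 2 : ℝ) : ℂ) =
      ∑ a, ∑ b, c a * conj (c b) * ξ a * conj (ξ b) := fun c => by
    rw [← Complex.normSq_eq_norm_sq, ← Complex.mul_conj, map_sum, Finset.sum_mul_sum]
    simp only [map_mul]
    exact Finset.sum_congr rfl fun a _ => Finset.sum_congr rfl fun b _ => by ring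
  have key2 : (normSq (Function.update ξ j 0) : ℂ) =
      ∑ a, ∑ b, (if a = b ∧ b ≠ j then 1 else 0) * ξ a * conj (ξ b) := by
    rw [ofReal_normSq]
    refine Finset.sum_congr rfl fun a _ => ?_
    rw [Finset.sum_eq_single a]
    · by_cases h : a = j <;> simp [h]
    · intro b _ hb
      simp [hb.symm]
    · simp
  have hq : (solitonQuad Φ j p ξ : ℂ) = (Φ (fibreNormSq (param j p : X n n)) : ℂ) *
      ((baseNormSq j p : ℂ)⁻¹ * (normSq (Function.update ξ j 0) : ℂ) -
        ((baseNormSq j p : ℂ) ^ 2)⁻¹ *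
          ((‖∑ a, conj (Function.update p j 0 a) * ξ a‖ ^ 2 : ℝ) : ℂ)) +
      ((n * deriv Φ (fibreNormSq (param j p : X n n)) * baseNormSq j p ^ n : ℝ) : ℂ) *
        ((‖∑ a, radialCovector j p a * ξ a‖ ^ 2 : ℝ) : ℂ) := by
    rw [solitonQuad]
    push_cast
    ring
  rw [hq, key, key, key2]
  simp only [Finset.mul_sum, ← Finset.sum_add_distrib, ← Finset.sum_sub_distrib]
  refine Finset.sum_congr rfl fun a _ => Finset.sum_congr rfl fun b _ => ?_
  simp only [solitonCoeff, fubiniStudy, Matrix.of_apply, Complex.conj_conj]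
  split_ifs <;> ring

theorem norm_sum_mul_sq_le (x y : Fin n → ℂ) :
    ‖∑ a, conj (x a) * y a‖ ^ 2 ≤ normSq x * normSq y := by
  have h1 : ‖∑ a, conj (x a) * y a‖ ≤ ∑ a, ‖x a‖ * ‖y a‖ := by
    refine (norm_sum_le _ _).trans (le_of_eq ?_)
    simp
  calc _ ≤ (∑ a, ‖x a‖ * ‖y a‖) ^ 2 := by gcongr
    _ ≤ _ := Finset.sum_mul_sq_le_sq_mul_sq _ _ _

namespace IsProfile

variable {a : ℝ} {Φ : ℝ → ℝ}

/-- Cauchy–Schwarz bounds the subtracted term by (N - 1)|ξ'|²/N², where ξ' omits slot j, and 1/N -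
(N - 1)/N² = 1/N². -/
theorem le_solitonQuad (h : IsProfile n a Φ) (j : Fin n) (p ξ : Fin n → ℂ) :
    Φ (fibreNormSq (param j p : X n n)) * normSq (Function.update ξ j 0) / baseNormSq j p ^ 2 +
    n * deriv Φ (fibreNormSq (param j p : X n n)) * baseNormSq j p ^ n *
      ‖∑ a, radialCovector j p a * ξ a‖ ^ 2 ≤ solitonQuad Φ j p ξ := by
  have hN := baseNormSq_pos j p
  have hN1 := baseNormSq_eq j p
  have hΦ := h.pos (fibreNormSq_nonneg (param j p : X n n))
  have e : ∑ a, conj (Function.update p j 0 a) * ξ a =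
      ∑ a, conj (Function.update p j 0 a) * Function.update ξ j 0 a :=
    Finset.sum_congr rfl fun a _ => by by_cases h : a = j <;> simp [h]
  have h1 := norm_sum_mul_sq_le (Function.update p j 0) (Function.update ξ j 0)
  rw [← e] at h1
  have h2 : normSq (Function.update p j 0) = baseNormSq j p - 1 := by linarith
  rw [h2] at h1
  rw [solitonQuad, mul_div_assoc]
  gcongr
  rw [div_sub_div _ _ hN.ne' (by positivity), div_le_div_iff₀ (by positivity) (by positivity)]
  have h3 : 0 ≤ ((baseNormSq j p - 1) * normSq (Function.update ξ j 0) -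
      ‖∑ a, conj (Function.update p j 0 a) * ξ a‖ ^ 2) * baseNormSq j p ^ 3 :=
    mul_nonneg (by linarith) (by positivity)
  nlinarith [h3]

theorem solitonQuad_pos (h : IsProfile n a Φ) (hn : n ≠ 0) (j : Fin n) (p : Fin n → ℂ)
    {ξ : Fin n → ℂ} (hξ : ξ ≠ 0) : 0 < solitonQuad Φ j p ξ := by
  have hN := baseNormSq_pos j p
  have hS := fibreNormSq_nonneg (param j p : X n n)
  have hΦ := h.pos hS
  have hΦ' := h.deriv_pos hn hS
  have hn' : (0 : ℝ) < n := by positivity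
  refine lt_of_lt_of_le ?_ (h.le_solitonQuad j p ξ)
  -- A purely vertical ξ is invisible to the Fubini–Study part, but the radial covector has the
  -- constant j-th entry 1/n and detects it.
  by_cases hz : Function.update ξ j 0 = 0
  · have h0 : ∀ k, k ≠ j → ξ k = 0 := fun k hk => by simpa [hk] using congrFun hz k
    have hj : ξ j ≠ 0 := fun hj => hξ (funext fun k => by
      by_cases hk : k = j
      · rw [hk, hj]; rfl
      · exact h0 k hk)
    have hs : ∑ a, radialCovector j p a * ξ a = (n : ℂ)⁻¹ * ξ j := by
      rw [Finset.sum_eq_single j (fun k _ hk => by simp [h0 k hk]) (by simp)]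
      simp [radialCovector]
    have hne : (n : ℂ)⁻¹ * ξ j ≠ 0 := mul_ne_zero (inv_ne_zero (Nat.cast_ne_zero.2 hn)) hj
    have := norm_pos_iff.2 hne
    rw [hs, hz]
    have h2 : normSq (0 : Fin n → ℂ) = 0 := by simp [normSq]
    rw [h2]
    simp only [mul_zero, zero_div, zero_add]
    positivity
  · have := normSq_pos hz
    positivity

theorem posDef_solitonCoeff (h : IsProfile n a Φ) (hn : n ≠ 0) (j : Fin n) (p : Fin n → ℂ) :
    (solitonCoeff Φ j p).PosDef := by
  refine Matrix.PosDef.of_dotProduct_mulVec_pos ?_ fun x hx => ?_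
  · ext a b
    have h1 : conj (fubiniStudy j p b a) = fubiniStudy j p a b := by
      by_cases hab : a = b
      · subst hab
        by_cases haj : a = j <;> simp [fubiniStudy, haj, mul_comm]
      · have hba : ¬ b = a := fun e => hab e.symm
        simp [fubiniStudy, hab, hba, mul_comm]
    simp [solitonCoeff, Matrix.conjTranspose_apply, h1, mul_comm]
  · have hx' : star x ≠ 0 := by simpa using hx
    -- `Matrix.PosDef` conjugates the vector on the left, whereas g_{a b̄} pairs with ξ_a ξ̄_b;
    -- hence ξ = `star x`.
    have h1 := sum_sum_solitonCoeff Φ j p (star x)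
    have h2 : star x ⬝ᵥ (solitonCoeff Φ j p).mulVec x = (solitonQuad Φ j p (star x) : ℂ) := by
      rw [← h1]
      simp only [dotProduct, Matrix.mulVec, Finset.mul_sum]
      refine Finset.sum_congr rfl fun a _ => Finset.sum_congr rfl fun b _ => ?_
      simp
      ring
    rw [h2]
    exact_mod_cast h.solitonQuad_pos hn j p hx'

theorem contDiff_solitonCoeff (h : IsProfile n a Φ) (j b c : Fin n) :
    ContDiff ℝ ∞ fun p => solitonCoeff Φ j p b c := by
  refine ((contDiff_ofReal_comp_fibreNormSq h.contDiffAt j).mul (contDiff_fubiniStudy j b c)).add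
    (ContDiff.mul ?_ ((contDiff_radialCovector j b).mul
      (contDiff_conj.comp (contDiff_radialCovector j c))))
  have h1 := contDiff_ofReal_comp_fibreNormSq (m := n) (fun s hs => h.contDiffAt_deriv hs) j
  have h2 := (contDiff_const (c := (n : ℂ))).mul (h1.mul ((contDiff_ofReal_baseNormSq j).pow n))
  convert h2 using 2
  push_cast
  ring

/-- Here u'' = nsΦ'(s) with s = |y|²N^n, and |y|² is distributed over ∂t and ∂̄t to form the radial
covector and its conjugate. -/
theorem solitonCoeff_eq_ddbar (h : IsProfile n a Φ) {j : Fin n} {p : Fin n → ℂ} (hp : p j ≠ 0) :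
    solitonCoeff Φ j p = ddbar (fun q => (potential n Φ (logCoord n j q) : ℂ)) p := by
  have hn : n ≠ 0 := j.pos.ne'
  have hc : conj (p j) ≠ 0 := by simpa using hp
  ext b c
  rw [ddbar_comp_logCoord hn j hp h.contDiff_potential.contDiffAt, h.deriv_deriv_potential,
    h.deriv_potential_apply, exp_logCoord hn j hp]
  have h1 : radialCovector j p b = p j * conj (dbarLog n j p b) := by
    rw [← Complex.conj_conj (radialCovector j p b), conj_radialCovector hp]
    simp
  have h2 : (fibreNormSq (param j p : X n n) : ℂ) = p j * conj (p j) * baseNormSq j p ^ n := by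
    rw [fibreNormSq_param, Complex.mul_conj, Complex.normSq_eq_norm_sq]
    push_cast
    rfl
  rw [solitonCoeff, Matrix.of_apply, conj_radialCovector hp, h1]
  push_cast
  rw [h2]
  ring

theorem continuous_solitonCoeff (h : IsProfile n a Φ) (j : Fin n) :
    Continuous (solitonCoeff Φ j) :=
  continuous_pi fun b => continuous_pi fun c => (h.contDiff_solitonCoeff j b c).continuous

end IsProfile

theorem continuousOn_pullback {τ : (Fin n → ℂ) → (Fin n → ℂ)} {W : Set (Fin n → ℂ)}
    {h : (Fin n → ℂ) → Matrix (Fin n) (Fin n) ℂ}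
    (hτ : ∀ p ∈ W, ContDiffAt ℂ ∞ τ p) (hh : Continuous h) : ContinuousOn (pullback τ h) W := by
  have h1 := continuousOn_jac hτ
  have hJ : ∀ k a, ContinuousOn (fun p => jac τ p k a) W := fun k a =>
    continuousOn_pi.1 (continuousOn_pi.1 h1 k) a
  have h2 : ContinuousOn (fun p => h (τ p)) W :=
    hh.comp_continuousOn fun p hp => (hτ p hp).continuousAt.continuousWithinAt
  have hH : ∀ k l, ContinuousOn (fun p => h (τ p) k l) W := fun k l =>
    continuousOn_pi.1 (continuousOn_pi.1 h2 k) l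
  refine continuousOn_pi.2 fun a => continuousOn_pi.2 fun b => ?_
  simp only [pullback_apply]
  exact continuousOn_finsetSum _ fun l _ => (continuousOn_finsetSum _ fun k _ =>
    (hJ k a).mul (hH k l)).mul (Complex.continuous_conj.comp_continuousOn (hJ l b))

namespace IsProfile

variable {a : ℝ} {Φ : ℝ → ℝ}

theorem solitonCoeff_transition (h : IsProfile n a Φ) (A : Matrix.unitaryGroup (Fin n) ℂ)
    (i j : Fin n) {p : Fin n → ℂ} (hp : p ∈ overlap n A i j) :
    solitonCoeff Φ i p = pullback (transition n A i j) (solitonCoeff Φ j) p := by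
  refine eqOn_of_dense (isOpen_overlap A i j) i (h.continuous_solitonCoeff i).continuousOn
    (continuousOn_pullback (fun q hq => contDiffAt_transition A i j hq)
      (h.continuous_solitonCoeff j)) ?_ hp
  intro q hq hqi
  rw [h.solitonCoeff_eq_ddbar hqi, ddbar_transition h.contDiff_potential A i j hq hqi, pullback,
    pullback, h.solitonCoeff_eq_ddbar (transition_ne_zero A i j hq hqi)]

theorem eventually_solitonCoeff_eq (h : IsProfile n a Φ) {j : Fin n} {p : Fin n → ℂ}
    (hp : p j ≠ 0) : ∀ᶠ q in 𝓝 p,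
      solitonCoeff Φ j q = ddbar (fun q => (potential n Φ (logCoord n j q) : ℂ)) q := by
  filter_upwards [(continuous_apply j).continuousAt.eventually_ne hp] with q hq
    using h.solitonCoeff_eq_ddbar hq

/-- Off the zero section the metric has a potential, so closedness is the commutation of ∂_d and
∂_b; the rest is continuity. -/
theorem dz_solitonCoeff_comm (h : IsProfile n a Φ) (j : Fin n) (p : Fin n → ℂ) (b c d : Fin n) :
    dz d (fun q => solitonCoeff Φ j q b c) p = dz b (fun q => solitonCoeff Φ j q d c) p := by
  have hcont : ∀ b d : Fin n, Continuous (dz d fun q => solitonCoeff Φ j q b c) := fun b d =>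
    continuous_iff_continuousAt.2 fun q =>
      (ContDiffAt.dz (h.contDiff_solitonCoeff j b c).contDiffAt d).continuousAt
  refine eqOn_of_dense isOpen_univ j (hcont b d).continuousOn (hcont d b).continuousOn ?_
    (Set.mem_univ p)
  intro q _ hq
  have e := h.eventually_solitonCoeff_eq hq
  have e' : ∀ b, (fun q => solitonCoeff Φ j q b c) =ᶠ[𝓝 q]
      dz b (dzbar c fun q => (potential n Φ (logCoord n j q) : ℂ)) := fun b =>
    e.mono fun r hr => congrFun (congrFun hr b) c
  rw [dz_congr (e' b), dz_congr (e' d)]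
  exact dz_dz_comm (ContDiffAt.dzbar (contDiffAt_potential h.contDiff_potential j hq) c) d b

end IsProfile

theorem rotate_one (x : X n m) : rotate 1 x = x := by
  induction x using Quotient.inductionOn with
  | h q =>
    change mk m ⟨((1 : Matrix (Fin n) (Fin n) ℂ).mulVec q.1.1, q.1.2), _⟩ = mk m q
    congr 1
    apply Subtype.ext
    simp

/-- The soliton metric on `X_n` with profile `Φ`. -/
def solitonMetric {a : ℝ} {Φ : ℝ → ℝ} (h : IsProfile n a Φ) (hn : n ≠ 0) : KahlerMetric n n where
  coeff := solitonCoeff Φ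
  smooth := h.contDiff_solitonCoeff
  posDef := h.posDef_solitonCoeff hn
  compat := fun i j p hp => by
    have h1 := h.solitonCoeff_transition 1 i j (p := p) (by
      rw [overlap, Set.mem_ofPred_eq, rotate_one]; exact hp)
    have h2 : transition n 1 i j = fun q => coord j (param i q : X n n) := by
      funext q
      rw [transition, rotate_one]
    rwa [h2] at h1
  kahler := fun j p b c d => h.dz_solitonCoeff_comm j p b c d

/-! ### The soliton equations -/

/-- If ∂_bF = μ h_{b j̄}, the raised gradient is μ in the single slot j̄. The Christoffel term
cancels μ ∂_a h_{b j̄}, and only ∂_aμ survives, so the Hessian vanishes for antiholomorphic μ. -/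
theorem hess_eq_of_dz_eq {h : (Fin n → ℂ) → Matrix (Fin n) (Fin n) ℂ} {F : (Fin n → ℂ) → ℂ}
    {p : Fin n → ℂ} {j : Fin n} {μ : (Fin n → ℂ) → ℂ} {A B : Fin n → ℂ}
    (hdet : IsUnit (h p).det) (hd : ∀ b, DifferentiableAt ℝ (fun q => h q b j) p)
    (hμ : HasW μ A B p) (hF : ∀ b, ∀ᶠ q in 𝓝 p, dz b F q = μ q * h q b j) (a b : Fin n) :
    hess h F a b p = A a * h p b j := by
  have h1 : dz a (dz b F) p = μ p * dz a (fun q => h q b j) p + h p b j * A a := by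
    rw [dz_congr (hF b) a, (hμ.mul (hasW_of_differentiableAt (hd b))).dz a]
  have h2 : ∑ k, christoffel h k a b p * dz k F p = μ p * dz a (fun q => h q b j) p := by
    have h3 : ∀ k, dz k F p = μ p * h p k j := fun k => (hF k).self_of_nhds
    simp only [christoffel, h3, Finset.sum_mul]
    rw [Finset.sum_comm]
    have h4 : ∀ l, ∑ k, dz a (fun q => h q b l) p * (h p)⁻¹ l k * (μ p * h p k j) =
        μ p * dz a (fun q => h q b l) p * (1 : Matrix (Fin n) (Fin n) ℂ) l j := fun l => by
      rw [← Matrix.nonsing_inv_mul _ hdet, Matrix.mul_apply, Finset.mul_sum]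
      exact Finset.sum_congr rfl fun k _ => by ring
    simp only [h4, Matrix.one_apply]
    rw [Finset.sum_eq_single j (fun l _ hl => by simp [hl]) (by simp)]
    simp
  rw [hess, h1, h2]
  ring

theorem dz_ofReal_logCoord (hm : m ≠ 0) {j : Fin n} {p : Fin n → ℂ} (hp : p j ≠ 0) {ψ : ℝ → ℝ}
    {ψ' : ℝ} (hψ : HasDerivAt ψ ψ' (logCoord m j p)) (b : Fin n) :
    dz b (fun q => (ψ (logCoord m j q) : ℂ)) p = ψ' * conj (dbarLog m j p b) :=
  ((hasW_logCoord hm j hp).ofReal_comp hψ).dz b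

/-- Column j of ∂∂̄t is zero and ∂̄_j t = 1/(mȳ), so column j of the metric is a multiple of ∂t.
This puts every function of t into the form required by `hess_eq_of_dz_eq`. -/
theorem ddbar_potential_self (hm : m ≠ 0) {j : Fin n} {p : Fin n → ℂ} (hp : p j ≠ 0) {u : ℝ → ℝ}
    (hu : ContDiff ℝ ∞ u) (b : Fin n) :
    m * conj (p j) * ddbar (fun q => (u (logCoord m j q) : ℂ)) p b j =
      deriv (deriv u) (logCoord m j p) * conj (dbarLog m j p b) := by
  have hc : conj (p j) ≠ 0 := by simpa using hp
  have hm' : (m : ℂ) ≠ 0 := Nat.cast_ne_zero.2 hm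
  rw [ddbar_comp_logCoord hm j hp hu.contDiffAt, fubiniStudy_self_right]
  simp only [dbarLog, if_true, Function.update_self, zero_div, add_zero, mul_zero, zero_add]
  field_simp

namespace IsProfile

variable {a : ℝ} {Φ : ℝ → ℝ}

theorem dz_comp_fibreNormSq (h : IsProfile n a Φ) (j : Fin n) (p : Fin n → ℂ) (b : Fin n) :
    dz b (fun q => (Φ (fibreNormSq (param j q : X n n)) : ℂ)) p =
      n * conj (p j) * solitonCoeff Φ j p b j := by
  have hn : n ≠ 0 := j.pos.ne'
  refine eqOn_of_dense isOpen_univ j (F := dz b _)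
    (G := fun p => n * conj (p j) * solitonCoeff Φ j p b j) ?_ ?_ ?_ (Set.mem_univ p)
  · exact (continuous_iff_continuousAt.2 fun q => (ContDiffAt.dz
      (contDiff_ofReal_comp_fibreNormSq h.contDiffAt j).contDiffAt b).continuousAt).continuousOn
  · exact ((continuous_const.mul (Complex.continuous_conj.comp (continuous_apply j))).mul
      (h.contDiff_solitonCoeff j b j).continuous).continuousOn
  · intro q _ hq
    have e : (fun q => (Φ (fibreNormSq (param j q : X n n)) : ℂ)) =ᶠ[𝓝 q]
        fun q => ((deriv (potential n Φ) (logCoord n j q) : ℝ) : ℂ) := by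
      filter_upwards [(continuous_apply j).continuousAt.eventually_ne hq] with r hr
      rw [h.deriv_potential_apply, exp_logCoord hn j hr]
    have hd : HasDerivAt (deriv (potential n Φ)) _ (logCoord n j q) :=
      ((contDiff_infty_iff_deriv.1 h.contDiff_potential).2.differentiable (by simp) _).hasDerivAt
    rw [dz_congr e, dz_ofReal_logCoord hn hq hd]
    change _ = n * conj (q j) * solitonCoeff Φ j q b j
    rw [h.solitonCoeff_eq_ddbar hq, ddbar_potential_self hn hq h.contDiff_potential]

/-- The differential equation replaces φ^{n-1}φ' by s e^{-Φ}, and s = |y|²N^n cancels the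
denominator exactly because m = n. -/
theorem det_solitonCoeff (h : IsProfile n a Φ) (j : Fin n) (p : Fin n → ℂ) :
    (solitonCoeff Φ j p).det =
      ((Real.exp (-Φ (fibreNormSq (param j p : X n n))) / n ^ 2 : ℝ) : ℂ) := by
  have hn : n ≠ 0 := j.pos.ne'
  refine eqOn_of_dense isOpen_univ j (F := fun p => (solitonCoeff Φ j p).det)
    (G := fun p => ((Real.exp (-Φ (fibreNormSq (param j p : X n n))) / n ^ 2 : ℝ) : ℂ)) ?_ ?_ ?_
    (Set.mem_univ p)
  · exact (Continuous.matrix_det (h.continuous_solitonCoeff j)).continuousOn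
  · refine (Complex.continuous_ofReal.comp ((Real.continuous_exp.comp
      (Continuous.neg ?_)).div_const _)).continuousOn
    exact (contDiff_comp_fibreNormSq h.contDiffAt j).continuous
  · intro q _ hq
    have hS : 0 < Real.exp (n * logCoord n j q) := Real.exp_pos _
    have hx := h.pos hS.le
    have h1 := h.soliton_equation hn (logCoord n j q)
    have hd : deriv (potential n Φ) (logCoord n j q) = Φ (fibreNormSq (param j q : X n n)) := by
      rw [h.deriv_potential_apply, exp_logCoord hn j hq]
    have hne : deriv (potential n Φ) (logCoord n j q) ≠ 0 := by
      rw [h.deriv_potential_apply]; exact hx.ne'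
    rw [h.solitonCoeff_eq_ddbar hq, det_ddbar_potential h.contDiff_potential hn hq hne]
    rw [hd, exp_logCoord hn j hq, ← eq_div_iff (Real.exp_pos _).ne'] at h1
    rw [hd, h1]
    congr 1
    rw [Real.exp_neg, fibreNormSq_param]
    have := (baseNormSq_pos j q).ne'
    have := norm_ne_zero_iff.2 hq
    field_simp

theorem ricci_solitonCoeff (h : IsProfile n a Φ) (j : Fin n) (p : Fin n → ℂ) (b c : Fin n) :
    ricci (solitonCoeff Φ j) b c p =
      dz b (dzbar c fun q => (Φ (fibreNormSq (param j q : X n n)) : ℂ)) p := by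
  have hn : n ≠ 0 := j.pos.ne'
  have e : (fun q => ((Real.log (solitonCoeff Φ j q).det.re : ℝ) : ℂ)) = fun q =>
      -(Φ (fibreNormSq (param j q : X n n)) : ℂ) - (Real.log (n ^ 2) : ℂ) := by
    funext q
    rw [h.det_solitonCoeff, Complex.ofReal_re, Real.log_div (Real.exp_pos _).ne'
      (by positivity), Real.log_exp]
    push_cast
    rfl
  have hd := contDiff_ofReal_comp_fibreNormSq (m := n) h.contDiffAt j
  have e1 : dzbar c (fun q => -(Φ (fibreNormSq (param j q : X n n)) : ℂ) -
      (Real.log (n ^ 2) : ℂ)) = fun q =>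
        -dzbar c (fun q => (Φ (fibreNormSq (param j q : X n n)) : ℂ)) q := by
    funext q
    rw [((hasW_of_differentiableAt ((hd.differentiable (by simp)) q)).neg.sub
      (HasW.const _ q)).dzbar c]
    simp
  rw [ricci, e, e1, (hasW_of_differentiableAt ((ContDiffAt.dzbar hd.contDiffAt c).differentiableAt
    (by simp))).neg.dz b, neg_neg]

theorem hess_solitonCoeff (h : IsProfile n a Φ) (j : Fin n) (p : Fin n → ℂ) (b c : Fin n) :
    hess (solitonCoeff Φ j) (fun q => (Φ (fibreNormSq (param j q : X n n)) : ℂ)) b c p = 0 := by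
  have hn : n ≠ 0 := j.pos.ne'
  rw [hess_eq_of_dz_eq (j := j) (μ := fun q => n * conj (q j))
    ((h.posDef_solitonCoeff hn j p).isUnit.map Matrix.detMonoidHom)
    (fun b => (h.contDiff_solitonCoeff j b j).differentiable (by simp) p)
    (((HasW.coord p j).conjugate).const_mul (n : ℂ))
    (fun b => .of_forall fun q => h.dz_comp_fibreNormSq j q b)]
  simp

end IsProfile

theorem isSteadyGradientSoliton_solitonMetric {a : ℝ} {Φ : ℝ → ℝ} (h : IsProfile n a Φ)
    (hn : n ≠ 0) :
    (solitonMetric h hn).IsSteadyGradientSoliton fun x => Φ (fibreNormSq x) := fun j =>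
  ⟨contDiff_comp_fibreNormSq h.contDiffAt j,
    fun p b c => ⟨h.ricci_solitonCoeff j p b c, h.hess_solitonCoeff j p b c⟩⟩

theorem hasRadialPotential_solitonMetric {a : ℝ} {Φ : ℝ → ℝ} (h : IsProfile n a Φ) (hn : n ≠ 0) :
    (solitonMetric h hn).HasRadialPotential (potential n Φ) := fun j z hz => by
  have h0 : coverCoord n j z j ≠ 0 := by
    rw [coverCoord_apply_self]; exact pow_ne_zero n hz
  rw [radialForm_eq_pullback h.contDiff_potential hn hz, pullback, pullback,
    ← h.solitonCoeff_eq_ddbar h0]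
  rfl

theorem rotationallySymmetric_solitonMetric {a : ℝ} {Φ : ℝ → ℝ} (h : IsProfile n a Φ)
    (hn : n ≠ 0) : (solitonMetric h hn).RotationallySymmetric :=
  fun A i j _ hp => h.solitonCoeff_transition A i j hp

/-! ### The Riemannian distance -/

namespace KahlerMetric

variable (g : KahlerMetric n m)

theorem continuous_coeff (j a b : Fin n) : Continuous fun p => g.coeff j p a b :=
  (g.smooth j a b).continuous

theorem continuous_speed (j : Fin n) {Y : Type*} [TopologicalSpace Y] {c ξ : Y → Fin n → ℂ}
    (hc : Continuous c) (hξ : Continuous ξ) :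
    Continuous fun t => √ (∑ a, ∑ b, g.coeff j (c t) a b * ξ t a * star (ξ t b)).re := by
  refine Real.continuous_sqrt.comp (Complex.continuous_re.comp ?_)
  refine continuous_finsetSum _ fun a _ => continuous_finsetSum _ fun b _ => ?_
  exact (((g.continuous_coeff j a b).comp hc).mul ((continuous_apply a).comp hξ)).mul
    (continuous_star.comp ((continuous_apply b).comp hξ))

theorem curveLength_nonneg (j : Fin n) (c : ℝ → Fin n → ℂ) : 0 ≤ curveLength (g.coeff j) c :=
  intervalIntegral.integral_nonneg zero_le_one fun _ _ => Real.sqrt_nonneg _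

variable {g}

theorem PathOfLength.nonneg {x y : X n m} {L : ℝ} (h : g.PathOfLength x y L) : 0 ≤ L := by
  induction h with
  | nil => exact le_rfl
  | snoc L j c hc h ih => exact add_nonneg ih (g.curveLength_nonneg j c)

theorem PathOfLength.append {x y z : X n m} {L L' : ℝ} (h : g.PathOfLength x y L)
    (h' : g.PathOfLength y z L') : g.PathOfLength x z (L + L') := by
  induction h' with
  | nil => simpa using h
  | snoc L' j c hc h' ih =>
    rw [← add_assoc]
    exact .snoc _ j c hc ih

theorem bddBelow_pathOfLength (x y : X n m) : BddBelow {L | g.PathOfLength x y L} :=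
  ⟨0, fun _ h => PathOfLength.nonneg h⟩

theorem distance_le {x y : X n m} {L : ℝ} (h : g.PathOfLength x y L) : g.distance x y ≤ L :=
  csInf_le (bddBelow_pathOfLength x y) h

theorem distance_nonneg (x y : X n m) : 0 ≤ g.distance x y :=
  Real.sInf_nonneg fun _ h => PathOfLength.nonneg h

/-- The straight segment in a chart. -/
def segment (p p' : Fin n → ℂ) (t : ℝ) : Fin n → ℂ := p + (t : ℂ) • (p' - p)

theorem hasDerivAt_segment (p p' : Fin n → ℂ) (t : ℝ) : HasDerivAt (segment p p') (p' - p) t := by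
  have h : HasDerivAt (fun t : ℝ => (t : ℂ)) 1 t := (hasDerivAt_id t).ofReal_comp
  exact ((h.smul_const (p' - p)).const_add p).congr_deriv (one_smul ℂ _)

theorem contDiff_segment (p p' : Fin n → ℂ) : ContDiff ℝ 1 (segment p p') :=
  contDiff_const.add (Complex.ofRealCLM.contDiff.smul contDiff_const)

theorem pathOfLength_segment (j : Fin n) (p p' : Fin n → ℂ) :
    g.PathOfLength (param j p) (param j p') (curveLength (g.coeff j) (segment p p')) := by
  have h := PathOfLength.snoc (g := g) (x := param j p) 0 j (segment p p') (contDiff_segment p p')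
    (by simpa [segment] using PathOfLength.nil)
  simpa [segment] using h

theorem tendsto_curveLength_segment (g : KahlerMetric n m) (j : Fin n) (p : Fin n → ℂ) :
    Filter.Tendsto (fun q => curveLength (g.coeff j) (segment q p)) (𝓝 p) (𝓝 0) := by
  have e : (fun q => curveLength (g.coeff j) (segment q p)) = fun q => ∫ t in (0 : ℝ)..1,
      √ (∑ a, ∑ b, g.coeff j (segment q p t) a b * (p - q) a * star ((p - q) b)).re := by
    funext q
    simp only [curveLength, (hasDerivAt_segment q p _).deriv]
  have hc : Continuous fun q => curveLength (g.coeff j) (segment q p) := by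
    rw [e]
    refine intervalIntegral.continuous_parametric_intervalIntegral_of_continuous' ?_ 0 1
    refine g.continuous_speed (Y := (Fin n → ℂ) × ℝ) j (c := fun x => segment x.1 p x.2)
      (ξ := fun x => p - x.1) ?_ (by fun_prop)
    unfold segment
    fun_prop
  have h0 : curveLength (g.coeff j) (segment p p) = 0 := by
    rw [congrFun e p]
    simp
  rw [← h0]
  exact hc.continuousAt

/-- The point of the zero section over `[1 : ⋯ : 1]`. -/
def basePoint (m : ℕ) (hn : n ≠ 0) : X n m :=
  LineBundleSoliton.mk m ⟨(fun _ => 1, 0), fun h => one_ne_zero (congrFun h ⟨0, Nat.pos_of_ne_zero hn⟩)⟩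

theorem basePoint_mem_domain (hn : n ≠ 0) (j : Fin n) : basePoint m hn ∈ domain j :=
  show (1 : ℂ) ≠ 0 from one_ne_zero

/-- Each chart is all of ℂⁿ and contains the base point, so two straight segments suffice. Without a
path the infimum over the empty set would be 0 and carry no information. -/
theorem exists_pathOfLength (g : KahlerMetric n m) (x y : X n m) : ∃ L, g.PathOfLength x y L := by
  obtain ⟨i, hi⟩ := exists_mem_domain x
  obtain ⟨j, hj⟩ := exists_mem_domain y
  have hn : n ≠ 0 := i.pos.ne'
  have h1 := pathOfLength_segment (g := g) i (coord i x) (coord i (basePoint m hn))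
  have h2 := pathOfLength_segment (g := g) j (coord j (basePoint m hn)) (coord j y)
  rw [param_coord hi, param_coord (basePoint_mem_domain hn i)] at h1
  rw [param_coord hj, param_coord (basePoint_mem_domain hn j)] at h2
  exact ⟨_, h1.append h2⟩

theorem exists_pathOfLength_lt {x y : X n m} {ε : ℝ} (h : g.distance x y < ε) :
    ∃ L, g.PathOfLength x y L ∧ L < ε :=
  exists_lt_of_csInf_lt (g.exists_pathOfLength x y) h

theorem distance_triangle (g : KahlerMetric n m) (x y z : X n m) :
    g.distance x z ≤ g.distance x y + g.distance y z := by
  refine le_of_forall_pos_le_add fun ε hε => ?_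
  obtain ⟨L, hL, hL'⟩ := exists_pathOfLength_lt (g := g) (x := x) (y := y)
    (ε := g.distance x y + ε / 2) (by linarith)
  obtain ⟨M, hM, hM'⟩ := exists_pathOfLength_lt (g := g) (x := y) (y := z)
    (ε := g.distance y z + ε / 2) (by linarith)
  linarith [distance_le (hL.append hM)]

theorem tendsto_distance {s : ℕ → X n m} {x : X n m} (h : Filter.Tendsto s Filter.atTop (𝓝 x)) :
    Filter.Tendsto (fun k => g.distance (s k) x) Filter.atTop (𝓝 0) := by
  obtain ⟨j, hj⟩ := exists_mem_domain x
  have h1 : Filter.Tendsto (fun k => coord j (s k)) Filter.atTop (𝓝 (coord j x)) :=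
    ((chart j).continuousAt hj).tendsto.comp h
  have h2 := (g.tendsto_curveLength_segment j (coord j x)).comp h1
  refine squeeze_zero' (.of_forall fun k => distance_nonneg _ _) ?_ h2
  filter_upwards [h.eventually ((isOpen_domain j).mem_nhds hj)] with k hk
  have h3 := distance_le (pathOfLength_segment (g := g) j (coord j (s k)) (coord j x))
  rwa [param_coord hk, param_coord hj] at h3

end KahlerMetric

/-- A representative with `|z| = 1`. -/
theorem exists_normSq_eq_one (x : X n m) : ∃ q : PreTotal n, normSq q.1.1 = 1 ∧ mk m q = x := by
  induction x using Quotient.inductionOn with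
  | h q =>
    have hN := normSq_pos q.2
    have hs : (√ (normSq q.1.1) : ℂ) ≠ 0 := Complex.ofReal_ne_zero.2 (Real.sqrt_pos.2 hN).ne'
    refine ⟨⟨((√ (normSq q.1.1) : ℂ)⁻¹ • q.1.1, (√ (normSq q.1.1) : ℂ) ^ m * q.1.2),
      smul_ne_zero (inv_ne_zero hs) q.2⟩, ?_, ?_⟩
    · rw [normSq_smul, norm_inv, Complex.norm_real, Real.norm_of_nonneg (Real.sqrt_nonneg _),
        inv_pow, Real.sq_sqrt hN.le, inv_mul_cancel₀ hN.ne']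
    · refine Quotient.sound (s := totalSetoid n m) ⟨(√ (normSq q.1.1) : ℂ), hs, ?_, rfl⟩
      rw [smul_smul, mul_inv_cancel₀ hs, one_smul]

/-- Points with s ≤ C have representatives in the compact set |z| = 1, |y|² ≤ C. -/
theorem exists_tendsto_subseq_of_fibreNormSq_le {s : ℕ → X n m} {C : ℝ}
    (h : ∀ k, fibreNormSq (s k) ≤ C) :
    ∃ x, ∃ σ : ℕ → ℕ, StrictMono σ ∧ Filter.Tendsto (s ∘ σ) Filter.atTop (𝓝 x) := by
  choose q hq1 hq2 using fun k => exists_normSq_eq_one (s k)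
  let K : Set ((Fin n → ℂ) × ℂ) := {w | normSq w.1 = 1 ∧ ‖w.2‖ ^ 2 ≤ C}
  have hK : IsCompact K := by
    refine Metric.isCompact_of_isClosed_isBounded ?_ ?_
    · exact (isClosed_eq (contDiff_normSq.continuous.comp continuous_fst) continuous_const).inter
        (isClosed_le (continuous_snd.norm.pow 2) continuous_const)
    · refine (Metric.isBounded_closedBall (x := (0 : (Fin n → ℂ) × ℂ)) (r := max 1 √C)).subset
        fun w hw => ?_
      rw [mem_closedBall_zero_iff, Prod.norm_def]
      refine max_le_max ((pi_norm_le_iff_of_nonneg zero_le_one).2 fun k => ?_)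
        (Real.le_sqrt_of_sq_le hw.2)
      have h1 : ‖w.1 k‖ ^ 2 ≤ normSq w.1 :=
        Finset.single_le_sum (f := fun k => ‖w.1 k‖ ^ 2) (fun _ _ => sq_nonneg _)
          (Finset.mem_univ k)
      rw [hw.1] at h1
      exact (sq_le_one_iff₀ (norm_nonneg _)).1 h1
  have hqK : ∀ k, (q k).1 ∈ K := fun k => ⟨hq1 k, by
    have := h k
    rw [← hq2 k, fibreNormSq_mk, hq1, one_pow, mul_one] at this
    exact this⟩
  obtain ⟨w, hw, σ, hσ, hlim⟩ := hK.tendsto_subseq hqK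
  have hw0 : w.1 ≠ 0 := fun h0 => by
    have := hw.1
    simp [h0, normSq] at this
  refine ⟨mk m ⟨w, hw0⟩, σ, hσ, ?_⟩
  have h1 : Filter.Tendsto (q ∘ σ) Filter.atTop (𝓝 (⟨w, hw0⟩ : PreTotal n)) :=
    tendsto_subtype_rng.2 hlim
  exact ((continuous_mk.tendsto _).comp h1).congr fun k => hq2 (σ k)

/-! ### Completeness of the soliton metric -/

/-- For real F the two Wirtinger parts are conjugate, so dF(ξ) = 2 Re ∑ ∂_kF ξ_k. -/
theorem wirt_of_real {F : (Fin n → ℂ) → ℝ} {A B p : Fin n → ℂ}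
    (h : HasW (fun q => (F q : ℂ)) A B p) (ξ : Fin n → ℂ) :
    ‖wirt A B ξ‖ ≤ 2 * ‖∑ k, A k * ξ k‖ := by
  have hB : ∀ k, B k = conj (A k) := fun k => by
    have h1 : HasW (fun q => (F q : ℂ)) _ _ p :=
      h.conjugate.congr_of_eventuallyEq (.of_forall fun q => (Complex.conj_ofReal _).symm)
    rw [← h.dzbar k, h1.dzbar k]
  have h2 : wirt A B ξ = ∑ k, A k * ξ k + conj (∑ k, A k * ξ k) := by
    rw [wirt_apply, map_sum, ← Finset.sum_add_distrib]
    exact Finset.sum_congr rfl fun k _ => by rw [hB, map_mul]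
  rw [h2]
  refine (norm_add_le _ _).trans ?_
  rw [RCLike.norm_conj]
  linarith

namespace IsProfile

variable {a : ℝ} {Φ : ℝ → ℝ}

/-- With c the radial covector, ∂Φ = nΦ'N^n ȳ c. The square of its value on ξ is n(sΦ') times the
radial part nΦ'N^n|c·ξ|² of the metric, and sΦ' ≤ 1. -/
theorem norm_sum_dz_le (h : IsProfile n a Φ) (j : Fin n) (p ξ : Fin n → ℂ) :
    ‖∑ k, dz k (fun q => (Φ (fibreNormSq (param j q : X n n)) : ℂ)) p * ξ k‖ ≤
      √n * √ (solitonQuad Φ j p ξ) := by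
  have hn : n ≠ 0 := j.pos.ne'
  have hn' : (0 : ℝ) < n := by positivity
  have hS := fibreNormSq_nonneg (param j p : X n n)
  have hN := baseNormSq_pos j p
  have hΦ' := h.deriv_pos hn hS
  have hΦ := h.pos hS
  have h1 : ∑ k, dz k (fun q => (Φ (fibreNormSq (param j q : X n n)) : ℂ)) p * ξ k =
      ((n * deriv Φ (fibreNormSq (param j p : X n n)) * baseNormSq j p ^ n : ℝ) : ℂ) *
        conj (p j) * ∑ k, radialCovector j p k * ξ k := by
    rw [Finset.mul_sum]
    refine Finset.sum_congr rfl fun k _ => ?_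
    have hc : radialCovector j p j = (n : ℂ)⁻¹ := by simp [radialCovector]
    have hn'' : (n : ℂ) ≠ 0 := Nat.cast_ne_zero.2 hn
    rw [h.dz_comp_fibreNormSq, solitonCoeff, Matrix.of_apply, fubiniStudy_self_right, hc]
    simp only [map_inv₀, map_natCast]
    field_simp
    ring
  rw [h1, ← Real.sqrt_mul hn'.le]
  refine Real.le_sqrt_of_sq_le ?_
  rw [norm_mul, norm_mul, RCLike.norm_conj, Complex.norm_real, Real.norm_of_nonneg (by positivity)]
  have h2 := h.le_solitonQuad j p ξ
  have h3 := h.mul_deriv_le_one hn hS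
  have h4 := normSq_nonneg (Function.update ξ j 0)
  have hK : 0 ≤ n * deriv Φ (fibreNormSq (param j p : X n n)) * baseNormSq j p ^ n *
      ‖∑ a, radialCovector j p a * ξ a‖ ^ 2 := by positivity
  have h5 : n * deriv Φ (fibreNormSq (param j p : X n n)) * baseNormSq j p ^ n *
      ‖∑ a, radialCovector j p a * ξ a‖ ^ 2 ≤ solitonQuad Φ j p ξ := by
    refine le_trans ?_ h2
    have : 0 ≤ Φ (fibreNormSq (param j p : X n n)) * normSq (Function.update ξ j 0) /
      baseNormSq j p ^ 2 := by positivity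
    linarith
  calc _ = n * ((fibreNormSq (param j p : X n n) * deriv Φ (fibreNormSq (param j p : X n n))) *
        (n * deriv Φ (fibreNormSq (param j p : X n n)) * baseNormSq j p ^ n *
          ‖∑ a, radialCovector j p a * ξ a‖ ^ 2)) := by
        conv_rhs => rw [fibreNormSq_param]
        rw [fibreNormSq_param]
        ring
    _ ≤ n * (1 * solitonQuad Φ j p ξ) := by gcongr
    _ = _ := by ring

/-- Integrating the gradient bound along the curve: Φ(s) is Lipschitz with constant 2√n. -/
theorem abs_sub_le_curveLength (h : IsProfile n a Φ) (j : Fin n) {c : ℝ → Fin n → ℂ}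
    (hc : ContDiff ℝ 1 c) :
    |Φ (fibreNormSq (param j (c 1) : X n n)) - Φ (fibreNormSq (param j (c 0) : X n n))| ≤
      2 * √n * curveLength (solitonCoeff Φ j) c := by
  have hn : n ≠ 0 := j.pos.ne'
  set F : (Fin n → ℂ) → ℂ := fun q => (Φ (fibreNormSq (param j q : X n n)) : ℂ) with hF
  have hFs : ContDiff ℝ ∞ F := contDiff_ofReal_comp_fibreNormSq h.contDiffAt j
  have hW : ∀ p, HasW F (fun k => dz k F p) (fun k => dzbar k F p) p := fun p =>
    hasW_of_differentiableAt (hFs.differentiable (by simp) p)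
  have hd : ∀ t, HasDerivAt (F ∘ c) (wirt (fun k => dz k F (c t)) (fun k => dzbar k F (c t))
      (deriv c t)) t := fun t =>
    (HasFDerivAt.comp_hasDerivAt t (hW (c t)) ((hc.differentiable (by simp) t).hasDerivAt))
  have hFc : ContDiff ℝ 1 (F ∘ c) := (hFs.of_le (by simp)).comp hc
  have hdc : Continuous (deriv (F ∘ c)) := hFc.continuous_deriv (by simp)
  have hint := intervalIntegral.integral_eq_sub_of_hasDerivAt (a := 0) (b := 1)
    (fun t _ => (hFc.differentiable (by simp) t).hasDerivAt) (hdc.intervalIntegrable 0 1)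
  have hq : ∀ t, √ (∑ a, ∑ b, solitonCoeff Φ j (c t) a b * deriv c t a * star (deriv c t b)).re =
      √ (solitonQuad Φ j (c t) (deriv c t)) := fun t => by
    have := sum_sum_solitonCoeff Φ j (c t) (deriv c t)
    simp only [Complex.star_def]
    rw [this, Complex.ofReal_re]
  have hsc : Continuous fun t => √ (solitonQuad Φ j (c t) (deriv c t)) := by
    simp only [← hq]
    exact (solitonMetric h hn).continuous_speed j hc.continuous (hc.continuous_deriv (by simp))
  have hle : ‖∫ t in (0 : ℝ)..1, deriv (F ∘ c) t‖ ≤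
      ∫ t in (0 : ℝ)..1, 2 * √n * √ (solitonQuad Φ j (c t) (deriv c t)) := by
    refine intervalIntegral.norm_integral_le_of_norm_le zero_le_one (.of_forall fun t _ => ?_)
      ((continuous_const.mul hsc).intervalIntegrable 0 1)
    rw [(hd t).deriv]
    refine (wirt_of_real (hW (c t)) _).trans ?_
    rw [mul_assoc]
    gcongr
    exact h.norm_sum_dz_le j (c t) (deriv c t)
  rw [hint] at hle
  rw [curveLength]
  simp only [hq]
  rw [← intervalIntegral.integral_const_mul]
  refine le_trans (le_of_eq ?_) hle
  rw [hF, Function.comp_apply, Function.comp_apply, ← Complex.ofReal_sub, Complex.norm_real,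
    Real.norm_eq_abs]

theorem abs_sub_le_of_pathOfLength (h : IsProfile n a Φ) (hn : n ≠ 0) {x y : X n n} {L : ℝ}
    (hL : (solitonMetric h hn).PathOfLength x y L) :
    |Φ (fibreNormSq y) - Φ (fibreNormSq x)| ≤ 2 * √n * L := by
  induction hL with
  | nil => simp
  | snoc L j c hc _ ih =>
    have h1 := h.abs_sub_le_curveLength j hc
    have h2 := abs_sub_le (Φ (fibreNormSq (param j (c 1) : X n n)))
      (Φ (fibreNormSq (param j (c 0) : X n n))) (Φ (fibreNormSq x))
    change _ ≤ 2 * √n * (L + curveLength (solitonCoeff Φ j) c)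
    linarith

end IsProfile

theorem isComplete_solitonMetric {a : ℝ} {Φ : ℝ → ℝ} (h : IsProfile n a Φ) (hn : n ≠ 0) :
    (solitonMetric h hn).IsComplete := by
  intro s hs
  -- A tail of the sequence stays within distance 1 of s N, where Φ is at most Φ at s N plus 2√n.
  -- This confines the tail to a set on which the invariant function is bounded.
  obtain ⟨N, hN⟩ := hs 1 one_pos
  have hb : ∀ k, fibreNormSq (s (N + k)) ≤ n * (Φ (fibreNormSq (s N)) + 2 * √n) ^ (n - 1) *
      Real.exp (Φ (fibreNormSq (s N)) + 2 * √n) := fun k => by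
    obtain ⟨L, hL, hL1⟩ := KahlerMetric.exists_pathOfLength_lt (hN N (N + k) le_rfl (by omega))
    have h1 := h.abs_sub_le_of_pathOfLength hn hL
    have h2 := le_abs_self (Φ (fibreNormSq (s (N + k))) - Φ (fibreNormSq (s N)))
    have h3 : 2 * √n * L ≤ 2 * √n * 1 := by gcongr
    exact h.le_of_map_le hn (fibreNormSq_nonneg _) (by linarith)
  obtain ⟨x, σ, hσ, hlim⟩ := exists_tendsto_subseq_of_fibreNormSq_le hb
  refine ⟨x, ?_⟩
  have hd := KahlerMetric.tendsto_distance (g := solitonMetric h hn) hlim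
  rw [Metric.tendsto_atTop]
  intro ε hε
  obtain ⟨N₁, hN₁⟩ := hs (ε / 2) (by linarith)
  refine ⟨N₁, fun k hk => ?_⟩
  -- A Cauchy sequence with a convergent subsequence converges: compare s k with one late member of
  -- the subsequence.
  obtain ⟨l, hl1, hl2⟩ := ((hd.eventually (gt_mem_nhds (half_pos hε))).and
    (Filter.eventually_ge_atTop N₁)).exists
  have h1 := hN₁ k (N + σ l) hk (by have := hσ.id_le l; simp only [id] at this; omega)
  have h2 := (solitonMetric h hn).distance_triangle (s k) (s (N + σ l)) x
  rw [Real.dist_eq, sub_zero, abs_of_nonneg (KahlerMetric.distance_nonneg _ _)]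
  simp only [Function.comp_apply] at hl1
  linarith

/-! ### The curvature of the fibres -/

theorem hasW_ofReal_fibreNormSq (j : Fin n) (p : Fin n → ℂ) :
    ∃ A B, HasW (fun q => (fibreNormSq (param j q : X n m) : ℂ)) A B p ∧
      A j = conj (p j) * baseNormSq j p ^ m ∧ B j = p j * baseNormSq j p ^ m := by
  have h1 := ((HasW.coord p j).mul (HasW.coord p j).conjugate).mul
    ((hasW_baseNormSq j p).ofReal_comp ((hasDerivAt_id (baseNormSq j p)).pow m))
  refine ⟨_, _, h1.congr_of_eventuallyEq (.of_forall fun q => ?_), ?_, ?_⟩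
  · change (fibreNormSq (param j q : X n m) : ℂ) =
      q j * conj (q j) * ((baseNormSq j q ^ m : ℝ) : ℂ)
    rw [fibreNormSq_param, Complex.mul_conj, Complex.normSq_eq_norm_sq]
    push_cast
    rfl
  · simp
    ring
  · simp
    ring

/-- On a fibre G = Φ'(s)N^n/n with N constant, so ∂_y∂_ȳ log G = N^n(ψ' + sψ'') for ψ = log Φ',
which is negative by `deriv_log_deriv_neg`. -/
theorem fibreCurvature_solitonMetric_pos {a : ℝ} {Φ : ℝ → ℝ} (h : IsProfile n a Φ) (hn : n ≠ 0)
    (j : Fin n) (p : Fin n → ℂ) : 0 < (solitonMetric h hn).fibreCurvature j p := by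
  have hn' : (0 : ℝ) < n := by positivity
  have hS : ∀ q, 0 ≤ fibreNormSq (param j q : X n n) := fun q => fibreNormSq_nonneg _
  have hG : ∀ q, ((solitonMetric h hn).coeff j q j j).re =
      deriv Φ (fibreNormSq (param j q : X n n)) * baseNormSq j q ^ n / n := fun q => by
    change (solitonCoeff Φ j q j j).re = _
    have hc : radialCovector j q j = ((n⁻¹ : ℝ) : ℂ) := by simp [radialCovector]
    rw [solitonCoeff, Matrix.of_apply, fubiniStudy_self_right, mul_zero, zero_add, hc,
      Complex.conj_ofReal, ← Complex.ofReal_mul, ← Complex.ofReal_mul, Complex.ofReal_re]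
    field_simp
  set ψ : ℝ → ℝ := fun r => Real.log (deriv Φ r) with hψ
  have hψs : ∀ s, 0 ≤ s → ContDiffAt ℝ ∞ ψ s := fun s hs => h.contDiffAt_log_deriv hn hs
  have hlog : ∀ q, HasW (fun q => (Real.log ((solitonMetric h hn).coeff j q j j).re : ℂ))
      (fun a => dz a (fun q => (Real.log ((solitonMetric h hn).coeff j q j j).re : ℂ)) q)
      (fun a => dzbar a (fun q => (Real.log ((solitonMetric h hn).coeff j q j j).re : ℂ)) q) q ∧
      dzbar j (fun q => (Real.log ((solitonMetric h hn).coeff j q j j).re : ℂ)) q =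
        (deriv ψ (fibreNormSq (param j q : X n n)) : ℝ) * (q j * baseNormSq j q ^ n) := fun q => by
    obtain ⟨A, B, h1, -, hB⟩ := hasW_ofReal_fibreNormSq (m := n) j q
    have h2 := ((h1.ofReal_comp ((hψs _ (hS q)).differentiableAt (by simp)).hasDerivAt).add
      (((hasW_baseNormSq j q).ofReal_comp
        (Real.hasDerivAt_log (baseNormSq_pos j q).ne')).const_mul (n : ℂ))).sub
          (HasW.const (Real.log n : ℂ) q)
    have h3 := h2.congr_of_eventuallyEq
      (G := fun q => (Real.log ((solitonMetric h hn).coeff j q j j).re : ℂ))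
      (.of_forall fun r => by
        have hN := baseNormSq_pos j r
        have hd := h.deriv_pos hn (hS r)
        change (Real.log ((solitonMetric h hn).coeff j r j j).re : ℂ) = _
        rw [hG, Real.log_div (by positivity) hn'.ne', Real.log_mul hd.ne' (by positivity),
          Real.log_pow]
        push_cast
        rfl)
    refine ⟨hasW_of_differentiableAt (HasFDerivAt.differentiableAt h3), ?_⟩
    rw [h3.dzbar j, hB]
    simp
  have hpt : dz j (dzbar j fun q => (Real.log ((solitonMetric h hn).coeff j q j j).re : ℂ)) p =
      ((baseNormSq j p ^ n * (deriv ψ (fibreNormSq (param j p : X n n)) +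
        fibreNormSq (param j p : X n n) *
          deriv (deriv ψ) (fibreNormSq (param j p : X n n))) : ℝ) : ℂ) := by
    obtain ⟨A, B, h1, hA, -⟩ := hasW_ofReal_fibreNormSq (m := n) j p
    have hψ2 := hasDerivAt_deriv_of_contDiffAt (hψs _ (hS p))
    have h2 := (h1.ofReal_comp hψ2).mul ((HasW.coord p j).mul
      ((hasW_baseNormSq j p).ofReal_comp ((hasDerivAt_id (baseNormSq j p)).pow n)))
    have e : (dzbar j fun q => (Real.log ((solitonMetric h hn).coeff j q j j).re : ℂ)) =
        fun q => ((deriv ψ (fibreNormSq (param j q : X n n)) : ℝ) : ℂ) *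
          (q j * ((baseNormSq j q ^ n : ℝ) : ℂ)) := by
      funext q
      rw [(hlog q).2]
      push_cast
      rfl
    have h3 : ((‖p j‖ ^ 2 : ℝ) : ℂ) = p j * conj (p j) := by
      simp [Complex.mul_conj, Complex.normSq_eq_norm_sq]
    rw [e]
    refine (h2.dz j).trans ?_
    rw [hA]
    conv_rhs => rw [Complex.ofReal_mul, Complex.ofReal_add, Complex.ofReal_mul]
    have h4 : (fibreNormSq (param j p : X n n) : ℂ) = p j * conj (p j) * baseNormSq j p ^ n := by
      rw [← h3, fibreNormSq_param]
      push_cast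
      rfl
    rw [h4]
    simp
    ring
  have hG0 : 0 < ((solitonMetric h hn).coeff j p j j).re := by
    rw [hG]
    have := h.deriv_pos hn (hS p)
    have := baseNormSq_pos j p
    positivity
  rw [KahlerMetric.fibreCurvature, hpt, Complex.ofReal_re, neg_mul, ← mul_neg, ← mul_neg]
  have h5 := h.deriv_log_deriv_neg hn (hS p)
  have := baseNormSq_pos j p
  exact mul_pos (by positivity) (mul_pos (by positivity) (neg_pos.2 h5))

/-! ### Classification of the rotationally symmetric solitons -/

/-- The unit vector z/|z| is extended to an orthonormal basis with z/|z| in position j. -/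
theorem exists_unitary_mulVec_single (j : Fin n) {z : Fin n → ℂ} (hz : z ≠ 0) :
    ∃ A : Matrix.unitaryGroup (Fin n) ℂ,
      A.1.mulVec (Pi.single j ((Real.exp (Real.log (normSq z) / 2) : ℝ) : ℂ)) = z := by
  have hN := normSq_pos hz
  have hr : Real.exp (Real.log (normSq z) / 2) = √ (normSq z) := by
    rw [Real.exp_half, Real.exp_log hN]
  have hs : (√ (normSq z) : ℂ) ≠ 0 := Complex.ofReal_ne_zero.2 (Real.sqrt_pos.2 hN).ne'
  let v : EuclideanSpace ℂ (Fin n) := WithLp.toLp 2 ((√ (normSq z) : ℂ)⁻¹ • z)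
  have hv : ‖v‖ = 1 := by
    have h1 : ‖v‖ ^ 2 = normSq ((√ (normSq z) : ℂ)⁻¹ • z) := by
      rw [EuclideanSpace.norm_sq_eq]
      rfl
    rw [normSq_smul, norm_inv, Complex.norm_real, Real.norm_of_nonneg (Real.sqrt_nonneg _),
        inv_pow, Real.sq_sqrt hN.le, inv_mul_cancel₀ hN.ne'] at h1
    exact (pow_eq_one_iff_of_nonneg (norm_nonneg v) two_ne_zero).1 h1
  have hon : Orthonormal ℂ (({j} : Set (Fin n)).domRestrict fun _ => v) := by
    refine ⟨fun _ => hv, fun x y hxy => ?_⟩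
    exact absurd (Subsingleton.elim x y) hxy
  obtain ⟨b, hb⟩ := hon.exists_orthonormalBasis_extension_of_card_eq (by simp)
  refine ⟨⟨(EuclideanSpace.basisFun (Fin n) ℂ).toBasis.toMatrix b,
    (EuclideanSpace.basisFun (Fin n) ℂ).toMatrix_orthonormalBasis_mem_unitary b⟩, ?_⟩
  funext k
  rw [hr, Matrix.mulVec_single]
  simp [Module.Basis.toMatrix_apply, hb j rfl, v]
  field_simp

/-- The point of the fibre over `[e_j]` with `log |z|² = t`, in the coordinates over `U_j`. -/
def fibrePoint (m : ℕ) (j : Fin n) (t : ℝ) : Fin n → ℂ :=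
  Pi.single j ((Real.exp (m * t / 2) : ℝ) : ℂ)

theorem fibrePoint_self (j : Fin n) (t : ℝ) :
    fibrePoint m j t j = ((Real.exp (m * t / 2) : ℝ) : ℂ) := Pi.single_eq_same _ _

theorem norm_sq_fibrePoint (j : Fin n) (t : ℝ) : ‖fibrePoint m j t j‖ ^ 2 = Real.exp (m * t) := by
  rw [fibrePoint_self, Complex.norm_real, Real.norm_of_nonneg (Real.exp_pos _).le,
    ← Real.exp_nat_mul]
  congr 1
  push_cast
  ring

theorem fibrePoint_ne_zero (j : Fin n) (t : ℝ) : fibrePoint m j t j ≠ 0 := by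
  rw [fibrePoint_self]
  exact Complex.ofReal_ne_zero.2 (Real.exp_pos _).ne'

theorem update_fibrePoint (j : Fin n) (t : ℝ) : Function.update (fibrePoint m j t) j 0 = 0 := by
  funext k
  by_cases h : k = j
  · subst h; simp
  · simp [fibrePoint, h]

theorem baseNormSq_fibrePoint (j : Fin n) (t : ℝ) : baseNormSq j (fibrePoint m j t) = 1 := by
  rw [baseNormSq_eq, update_fibrePoint]
  simp [normSq]

theorem logCoord_fibrePoint (hm : m ≠ 0) (j : Fin n) (t : ℝ) :
    logCoord m j (fibrePoint m j t) = t := by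
  have : (m : ℝ) ≠ 0 := Nat.cast_ne_zero.2 hm
  rw [logCoord_eq hm j (fibrePoint_ne_zero j t), norm_sq_fibrePoint, baseNormSq_fibrePoint,
    Real.log_exp, Real.log_one, add_zero, mul_div_cancel_left₀ _ this]

theorem contDiff_fibrePoint (j : Fin n) : ContDiff ℝ ∞ (fibrePoint m j : ℝ → Fin n → ℂ) := by
  refine contDiff_pi.2 fun k => ?_
  by_cases h : k = j
  · subst h
    simp only [fibrePoint_self]
    exact Complex.ofRealCLM.contDiff.comp (Real.contDiff_exp.comp
      ((contDiff_const.mul contDiff_id).div_const _))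
  · simp only [fibrePoint, Pi.single_eq_of_ne h]
    exact contDiff_const

theorem tendsto_fibrePoint (hm : m ≠ 0) (j : Fin n) :
    Filter.Tendsto (fibrePoint m j : ℝ → Fin n → ℂ) Filter.atBot (𝓝 0) := by
  have hm' : (0 : ℝ) < m := by positivity
  refine tendsto_pi_nhds.2 fun k => ?_
  by_cases h : k = j
  · subst h
    simp only [fibrePoint_self]
    have h1 : Filter.Tendsto (fun t : ℝ => m * t / 2) Filter.atBot Filter.atBot :=
      (Filter.tendsto_id.const_mul_atBot hm').atBot_div_const two_pos
    exact (Complex.continuous_ofReal.tendsto' 0 0 Complex.ofReal_zero).comp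
      (Real.tendsto_exp_atBot.comp h1)
  · simp only [fibrePoint, Pi.single_eq_of_ne h]
    exact tendsto_const_nhds

/-- A rotationally invariant function depends on `log |z|²` only. -/
theorem apply_param_eq_of_invariant (hm : m ≠ 0) {f : X n m → ℝ}
    (hf : ∀ (A : Matrix.unitaryGroup (Fin n) ℂ) (x : X n m), f (rotate A x) = f x)
    (j : Fin n) {p : Fin n → ℂ} (hp : p j ≠ 0) :
    f (param j p) = f (param j (fibrePoint m j (logCoord m j p))) := by
  obtain ⟨z, hz, rfl⟩ := exists_coverCoord_eq hm hp
  have hz0 := ne_zero_of_apply hz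
  obtain ⟨A, hA⟩ := exists_unitary_mulVec_single j hz0
  set r : ℂ := ((Real.exp (Real.log (normSq z) / 2) : ℝ) : ℂ) with hr
  have hr0 : (Pi.single j r : Fin n → ℂ) j ≠ 0 := by
    rw [Pi.single_eq_same]; exact Complex.ofReal_ne_zero.2 (Real.exp_pos _).ne'
  have h1 : cover m z hz0 = rotate A (cover m (Pi.single j r) (ne_zero_of_apply hr0)) := by
    change mk m ⟨(z, 1), _⟩ = mk m ⟨(A.1.mulVec (Pi.single j r), 1), _⟩
    congr 1
    exact Subtype.ext (Prod.ext hA.symm rfl)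
  have h2 : coverCoord m j (Pi.single j r) = fibrePoint m j (Real.log (normSq z)) := by
    funext k
    by_cases h : k = j
    · subst h
      rw [coverCoord_apply_self, fibrePoint_self, Pi.single_eq_same, hr, ← Complex.ofReal_pow,
        ← Real.exp_nat_mul]
      congr 2
      ring
    · simp [coverCoord, fibrePoint, h]
  rw [param_coverCoord hz, h1, hf, ← param_coverCoord hr0, h2, logCoord_coverCoord hm hz]

/-! ### Consequences of the soliton equations along one fibre -/

namespace KahlerMetric.HasRadialPotential

variable {g : KahlerMetric n m} {u : ℝ → ℝ}

/-- The parametrization is onto y ≠ 0, by taking m-th roots, and its Jacobian is invertible, so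
equality of the pull-backs descends. -/
theorem coeff_eq_ddbar (h : g.HasRadialPotential u) (hu : ContDiff ℝ ∞ u) (hm : m ≠ 0) {j : Fin n}
    {p : Fin n → ℂ} (hp : p j ≠ 0) :
    g.coeff j p = ddbar (fun q => (u (logCoord m j q) : ℂ)) p := by
  obtain ⟨z, hz, rfl⟩ := exists_coverCoord_eq hm hp
  refine eq_of_pullback_eq (τ := coverCoord m j) (p := z) ?_
    ((h j z hz).symm.trans (radialForm_eq_pullback hu hm hz))
  rw [det_jac_coverCoord hz]
  have : (m : ℂ) ≠ 0 := Nat.cast_ne_zero.2 hm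
  have := inv_ne_zero hz
  positivity

theorem coeff_fibrePoint (h : g.HasRadialPotential u) (hu : ContDiff ℝ ∞ u) (hm : m ≠ 0)
    {j k : Fin n} (hk : k ≠ j) (t : ℝ) :
    g.coeff j (fibrePoint m j t) k k = ((deriv u t : ℝ) : ℂ) := by
  rw [h.coeff_eq_ddbar hu hm (fibrePoint_ne_zero j t),
    ddbar_comp_logCoord hm j (fibrePoint_ne_zero j t) hu.contDiffAt, logCoord_fibrePoint hm,
    fubiniStudy, dbarLog, Matrix.of_apply, update_fibrePoint, baseNormSq_fibrePoint]
  simp [hk]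

theorem coeff_fibrePoint_self (h : g.HasRadialPotential u) (hu : ContDiff ℝ ∞ u) (hm : m ≠ 0)
    (j : Fin n) (t : ℝ) :
    g.coeff j (fibrePoint m j t) j j =
      ((deriv (deriv u) t / (m ^ 2 * Real.exp (m * t)) : ℝ) : ℂ) := by
  have h0 := fibrePoint_ne_zero (m := m) j t
  have hm' : (m : ℂ) ≠ 0 := Nat.cast_ne_zero.2 hm
  have hE : (Real.exp (m * t) : ℂ) = fibrePoint m j t j * conj (fibrePoint m j t j) := by
    rw [Complex.mul_conj, Complex.normSq_eq_norm_sq, norm_sq_fibrePoint]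
  have h1 : conj (fibrePoint m j t j) ≠ 0 := by simpa using h0
  rw [h.coeff_eq_ddbar hu hm h0, ddbar_comp_logCoord hm j h0 hu.contDiffAt,
    logCoord_fibrePoint hm, fubiniStudy_self_right, dbarLog, update_fibrePoint]
  rw [Complex.ofReal_div, Complex.ofReal_mul, hE]
  simp
  field_simp

theorem deriv_pos (h : g.HasRadialPotential u) (hu : ContDiff ℝ ∞ u) (hm : m ≠ 0)
    {j k : Fin n} (hk : k ≠ j) (t : ℝ) : 0 < deriv u t := by
  have h1 := (g.posDef j (fibrePoint m j t)).diag_pos (i := k)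
  rw [h.coeff_fibrePoint hu hm hk] at h1
  exact_mod_cast h1

theorem deriv_deriv_pos (h : g.HasRadialPotential u) (hu : ContDiff ℝ ∞ u) (hm : m ≠ 0)
    (j : Fin n) (t : ℝ) : 0 < deriv (deriv u) t := by
  have h1 := (g.posDef j (fibrePoint m j t)).diag_pos (i := j)
  rw [h.coeff_fibrePoint_self hu hm] at h1
  have h2 : (0 : ℝ) < deriv (deriv u) t / (m ^ 2 * Real.exp (m * t)) := by exact_mod_cast h1
  have hm' : (0 : ℝ) < m := by positivity
  exact (div_pos_iff_of_pos_right (by positivity)).1 h2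

theorem tendsto_coeff_re (g : KahlerMetric n m) (hm : m ≠ 0) (j k : Fin n) :
    0 < (g.coeff j 0 k k).re ∧ Filter.Tendsto (fun t => (g.coeff j (fibrePoint m j t) k k).re)
      Filter.atBot (𝓝 (g.coeff j 0 k k).re) :=
  ⟨(Complex.pos_iff.1 (g.posDef j 0).diag_pos).1,
    ((Complex.continuous_re.comp (g.continuous_coeff j k k)).tendsto 0).comp
      (tendsto_fibrePoint hm j)⟩

/-- Along the fibre over [e_j], φ is the component of g in a base direction; its limit is that
component on the zero section, which is positive. -/
theorem tendsto_deriv (h : g.HasRadialPotential u) (hu : ContDiff ℝ ∞ u) (hm : m ≠ 0)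
    {j k : Fin n} (hk : k ≠ j) :
    ∃ a, 0 < a ∧ Filter.Tendsto (deriv u) Filter.atBot (𝓝 a) := by
  obtain ⟨h1, h2⟩ := tendsto_coeff_re g hm j k
  refine ⟨_, h1, h2.congr fun t => ?_⟩
  rw [h.coeff_fibrePoint hu hm hk, Complex.ofReal_re]

/-- Vanishing of the `(2,0)`-part of the Hessian makes `f` an affine function of `u'`. -/
theorem exists_affine (h : g.HasRadialPotential u) (hu : ContDiff ℝ ∞ u) (hm : m ≠ 0) (j : Fin n)
    {F : ℝ → ℝ} (hF : ContDiff ℝ ∞ F) {f : X n m → ℝ} (hs : g.IsSteadyGradientSoliton f)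
    (hfF : ∀ p : Fin n → ℂ, p j ≠ 0 → f (param j p) = F (logCoord m j p)) :
    ∃ α c : ℝ, ∀ t, F t = α * deriv u t + c := by
  have hu1 : ContDiff ℝ ∞ (deriv u) := (contDiff_infty_iff_deriv.1 hu).2
  have hu2 : ContDiff ℝ ∞ (deriv (deriv u)) := (contDiff_infty_iff_deriv.1 hu1).2
  have hF1 : ContDiff ℝ ∞ (deriv F) := (contDiff_infty_iff_deriv.1 hF).2
  have hpos := h.deriv_deriv_pos hu hm j
  set lam : ℝ → ℝ := fun t => deriv F t / deriv (deriv u) t with hlam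
  have hlams : ContDiff ℝ ∞ lam := hF1.div hu2 fun t => (hpos t).ne'
  have hlam0 : ∀ t, deriv lam t = 0 := fun t => by
    have h0 := fibrePoint_ne_zero (m := m) j t
    have e := (continuous_apply j).continuousAt.eventually_ne h0
    -- Here ∂_b f = μ g_{b j̄} with μ = λ(t) m ȳ and λ = F'/u''. Thus f_{,jj} is λ'(t) times the
    -- nonzero factor ∂_j t · mȳ · g_{j j̄}.
    have hμ := ((hasW_logCoord hm j h0).ofReal_comp
      ((hlams.differentiable (by simp) _).hasDerivAt)).mul
        (((HasW.coord (fibrePoint m j t) j).conjugate).const_mul (m : ℂ))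
    have h1 := hess_eq_of_dz_eq (h := g.coeff j) (j := j)
      (F := fun q => (f (param j q) : ℂ)) ((g.posDef j _).isUnit.map Matrix.detMonoidHom)
      (fun b => (g.smooth j b j).differentiable (by simp) _) hμ (fun b => by
        filter_upwards [e, e.eventually_nhds] with q hq hq'
        have e1 : (fun q => (f (param j q) : ℂ)) =ᶠ[𝓝 q] fun q => (F (logCoord m j q) : ℂ) :=
          hq'.mono fun r hr => congrArg Complex.ofReal (hfF r hr)
        rw [dz_congr e1, dz_ofReal_logCoord hm hq ((hF.differentiable (by simp) _).hasDerivAt),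
          mul_assoc, h.coeff_eq_ddbar hu hm hq, ddbar_potential_self hm hq hu, hlam,
          Complex.ofReal_div]
        have : ((deriv (deriv u) (logCoord m j q) : ℝ) : ℂ) ≠ 0 :=
          Complex.ofReal_ne_zero.2 (hpos _).ne'
        field_simp) j j
    rw [((hs j).2 _ j j).2] at h1
    have h2 : g.coeff j (fibrePoint m j t) j j ≠ 0 := (g.posDef j _).diag_pos.ne'
    have h3 := (mul_eq_zero.1 h1.symm).resolve_right h2
    rw [logCoord_fibrePoint hm] at h3
    simpa [dbarLog, hm, h0] using h3
  have hdiff : Differentiable ℝ lam := hlams.differentiable (by simp)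
  have hconst : ∀ t, deriv F t = lam 0 * deriv (deriv u) t := fun t => by
    rw [← is_const_of_deriv_eq_zero hdiff hlam0 t 0, hlam]
    exact (div_mul_cancel₀ _ (hpos t).ne').symm
  have hd : ∀ t, HasDerivAt (fun t => F t - lam 0 * deriv u t)
      (deriv F t - lam 0 * deriv (deriv u) t) t := fun t =>
    ((hF.differentiable (by simp) t).hasDerivAt).sub
      (((hu1.differentiable (by simp) t).hasDerivAt).const_mul _)
  refine ⟨lam 0, F 0 - lam 0 * deriv u 0, fun t => ?_⟩
  have := is_const_of_deriv_eq_zero (fun t => (hd t).differentiableAt)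
    (fun t => by rw [(hd t).deriv, hconst, sub_self]) t 0
  linarith

/-- The `(1,1)`-part of the soliton equation, integrated. -/
theorem exists_log_eq (h : g.HasRadialPotential u) (hu : ContDiff ℝ ∞ u) (hm : m ≠ 0)
    {j k : Fin n} (hk : k ≠ j) {F : ℝ → ℝ} (hF : ContDiff ℝ ∞ F) {f : X n m → ℝ}
    (hs : g.IsSteadyGradientSoliton f)
    (hfF : ∀ p : Fin n → ℂ, p j ≠ 0 → f (param j p) = F (logCoord m j p)) :
    ∃ c : ℝ, ∀ t, Real.log (deriv u t ^ (n - 1) * deriv (deriv u) t) + F t = n * t + c := by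
  have hu1 : ContDiff ℝ ∞ (deriv u) := (contDiff_infty_iff_deriv.1 hu).2
  have hu2 : ContDiff ℝ ∞ (deriv (deriv u)) := (contDiff_infty_iff_deriv.1 hu1).2
  have hφ := h.deriv_pos hu hm hk
  have hφ' := h.deriv_deriv_pos hu hm j
  have hmr : (m : ℝ) ≠ 0 := Nat.cast_ne_zero.2 hm
  set G : ℝ → ℝ := fun t => Real.log (deriv u t ^ (n - 1) * deriv (deriv u) t) with hG
  have hGs : ContDiff ℝ ∞ G := ((hu1.pow _).mul hu2).log fun t =>
    (mul_pos (pow_pos (hφ t) _) (hφ' t)).ne'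
  -- Use the (k, k̄)-entry over [e_j]: there ∂_k t = 0 and ∂_k∂_k̄ t = 1, so the second derivatives
  -- of G and F drop out and a first-order identity remains.
  have key : ∀ t, deriv G t + deriv F t = n := fun t => by
    have h0 := fibrePoint_ne_zero (m := m) j t
    have e := (continuous_apply j).continuousAt.eventually_ne h0
    have e1 : (fun q => (f (param j q) : ℂ)) =ᶠ[𝓝 (fibrePoint m j t)]
        fun q => (F (logCoord m j q) : ℂ) := e.mono fun r hr => congrArg Complex.ofReal (hfF r hr)
    have hv : dbarLog m j (fibrePoint m j t) k = 0 := by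
      simp [dbarLog, fibrePoint, hk]
    have hfs : fubiniStudy j (fibrePoint m j t) k k = 1 := by
      simp [fubiniStudy, update_fibrePoint, baseNormSq_fibrePoint, hk]
    -- The determinant formula, with log |y|² = m(t - log N).
    have hlog : ∀ q : Fin n → ℂ, q j ≠ 0 → Real.log (g.coeff j q).det.re =
        G (logCoord m j q) - m * logCoord m j q - (n - m) * Real.log (baseNormSq j q) -
          Real.log (m ^ 2) := fun q hq => by
      have h1 := det_ddbar_potential hu hm hq (hφ _).ne'
      have h2 := logCoord_eq hm j hq
      have h3 := norm_pos_iff.2 hq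
      have h4 := baseNormSq_pos j q
      have h6 : ∀ t, Real.log (deriv u t ^ (n - 1) * deriv (deriv u) t) = G t := fun _ => rfl
      rw [h.coeff_eq_ddbar hu hm hq, h1, Complex.ofReal_re, Real.log_div
        (mul_pos (pow_pos (hφ _) _) (hφ' _)).ne' (by positivity), h6, Real.log_mul (by positivity)
        (by positivity), Real.log_mul (by positivity) (by positivity),
        Real.log_pow (baseNormSq j q)]
      have h5 : Real.log (‖q j‖ ^ 2) = m * logCoord m j q - m * Real.log (baseNormSq j q) := by
        rw [h2]
        field_simp
        ring
      rw [h5]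
      ring
    -- For k ≠ j the derivatives ∂_k̄ of t and of log N agree, so the coefficients -m and -(n - m)
    -- add up to -n for every m.
    have e2 : dzbar k (fun q => ((Real.log (g.coeff j q).det.re : ℝ) : ℂ))
        =ᶠ[𝓝 (fibrePoint m j t)]
        fun q => (((fun t => deriv G t - n) (logCoord m j q) : ℝ) : ℂ) * dbarLog m j q k := by
      filter_upwards [e, e.eventually_nhds] with q hq hq'
      have hW := ((((hasW_logCoord hm j hq).ofReal_comp
        ((hGs.differentiable (by simp) _).hasDerivAt)).sub
        ((hasW_logCoord hm j hq).const_mul (m : ℂ))).sub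
        (((hasW_baseNormSq j q).ofReal_comp
          (Real.hasDerivAt_log (baseNormSq_pos j q).ne')).const_mul ((n : ℂ) - m))).sub
        (HasW.const (Real.log (m ^ 2) : ℂ) q)
      rw [(hW.congr_of_eventuallyEq (hq'.mono fun r hr => by
        rw [hlog r hr]
        push_cast
        rfl)).dzbar k]
      simp [dbarLog, hk]
      field_simp
      ring
    have hGd : HasDerivAt (fun t => deriv G t - n) (deriv (deriv G) t)
        (logCoord m j (fibrePoint m j t)) := by
      rw [logCoord_fibrePoint hm]
      exact (hasDerivAt_deriv_of_contDiffAt hGs.contDiffAt).sub_const _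
    obtain ⟨C', hC'⟩ := hasW_dbarLog (m := m) j (fun _ => h0) k
    have h1 := ((hs j).2 (fibrePoint m j t) k k).1
    have h2 := ddbar_comp_logCoord hm j h0 hF.contDiffAt k k
    rw [ddbar_apply] at h2
    rw [dz_congr (dzbar_eventuallyEq e1 k), h2, ricci, dz_congr e2,
      (((hasW_logCoord hm j h0).ofReal_comp hGd).mul hC').dz k, hv, hfs,
      logCoord_fibrePoint hm] at h1
    simp only [mul_zero, zero_mul, add_zero, mul_one] at h1
    have h3 : -(deriv G t - n) = deriv F t := by exact_mod_cast h1
    linarith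
  have hd : ∀ t, HasDerivAt (fun t => G t + F t - n * t) (deriv G t + deriv F t - n * 1) t :=
    fun t => (((hGs.differentiable (by simp) t).hasDerivAt).add
      ((hF.differentiable (by simp) t).hasDerivAt)).sub ((hasDerivAt_id t).const_mul _)
  refine ⟨G 0 + F 0, fun t => ?_⟩
  have := is_const_of_deriv_eq_zero (fun t => (hd t).differentiableAt)
    (fun t => by rw [(hd t).deriv, key, mul_one, sub_self]) t 0
  simp only [mul_zero, sub_zero] at this
  change G t + F t = _
  linarith

/-- Solving the equation for e^{(n-m)t} leaves only quantities with positive limits as t → -∞: the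
fibre component g_{j j̄} = φ'/(m²e^{mt}), which extends to the zero section, and φ. For m ≠ n the
exponential tends to 0 or to ∞. -/
theorem degree_eq (h : g.HasRadialPotential u) (hu : ContDiff ℝ ∞ u) (hm : m ≠ 0)
    (j : Fin n) {α β a : ℝ} (hβ : 0 < β) (ha : 0 < a)
    (hode : ∀ t, deriv u t ^ (n - 1) * deriv (deriv u) t * Real.exp (α * deriv u t) =
      β * Real.exp (n * t))
    (hlim : Filter.Tendsto (deriv u) Filter.atBot (𝓝 a)) : m = n := by
  obtain ⟨hH, hHlim⟩ := tendsto_coeff_re g hm j j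
  set H := (g.coeff j 0 j j).re
  have hm' : (0 : ℝ) < m := by positivity
  have hE : ∀ t, Real.exp ((n - m) * t) = m ^ 2 / β * ((g.coeff j (fibrePoint m j t) j j).re *
      deriv u t ^ (n - 1) * Real.exp (α * deriv u t)) := fun t => by
    rw [h.coeff_fibrePoint_self hu hm, Complex.ofReal_re, sub_mul, Real.exp_sub]
    have h1 := hode t
    field_simp
    linarith
  have hlim' : Filter.Tendsto (fun t : ℝ => Real.exp ((n - m) * t)) Filter.atBot
      (𝓝 (m ^ 2 / β * (H * a ^ (n - 1) * Real.exp (α * a)))) := by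
    simp only [hE]
    exact ((hHlim.mul (hlim.pow _)).mul
      ((Real.continuous_exp.tendsto _).comp (hlim.const_mul α))).const_mul _
  have hK : 0 < m ^ 2 / β * (H * a ^ (n - 1) * Real.exp (α * a)) := by positivity
  rcases lt_trichotomy m n with hlt | heq | hgt
  · have h1 : (0 : ℝ) < n - m := sub_pos.2 (Nat.cast_lt.2 hlt)
    have h2 : Filter.Tendsto (fun t : ℝ => Real.exp ((n - m) * t)) Filter.atBot (𝓝 0) :=
      Real.tendsto_exp_atBot.comp (Filter.tendsto_id.const_mul_atBot h1)
    exact absurd (tendsto_nhds_unique hlim' h2) hK.ne'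
  · exact heq
  · have h1 : (n : ℝ) - m < 0 := sub_neg.2 (Nat.cast_lt.2 hgt)
    have h2 : Filter.Tendsto (fun t : ℝ => Real.exp ((n - m) * t)) Filter.atBot Filter.atTop :=
      Real.tendsto_exp_atTop.comp (Filter.tendsto_id.const_mul_atBot_of_neg h1)
    exact absurd hlim' (not_tendsto_nhds_of_tendsto_atTop h2 _)

end KahlerMetric.HasRadialPotential

end LineBundleSoliton

end

/-! ### Assembly of both directions -/

theorem theorem2 (n : ℕ) (hn : 2 ≤ n) :
    (∀ a : ℝ, 0 < a →
      ∃ (u : ℝ → ℝ) (g : LineBundleSoliton.KahlerMetric n n) (f : LineBundleSoliton.X n n → ℝ),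
        ContDiff ℝ (⊤ : ℕ∞) u ∧
        (∀ t, 0 < deriv u t ∧ 0 < deriv (deriv u) t) ∧
        (∀ t, deriv u t ^ (n - 1) * deriv (deriv u) t * Real.exp (deriv u t) =
          Real.exp (n * t)) ∧
        Filter.Tendsto (deriv u) Filter.atBot (nhds a) ∧
        g.HasRadialPotential u ∧
        g.RotationallySymmetric ∧
        g.IsSteadyGradientSoliton f ∧
        (∀ (z : Fin n → ℂ) (hz : z ≠ 0), f (LineBundleSoliton.cover n z hz) =
          deriv u (Real.log (LineBundleSoliton.normSq z))) ∧
        g.IsComplete ∧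
        (∀ j p, 0 < g.fibreCurvature j p)) ∧
    (∀ (m : ℕ), 1 ≤ m →
      ∀ (u : ℝ → ℝ) (g : LineBundleSoliton.KahlerMetric n m) (f : LineBundleSoliton.X n m → ℝ),
        ContDiff ℝ (⊤ : ℕ∞) u →
        g.HasRadialPotential u →
        g.IsSteadyGradientSoliton f →
        (∀ (A : Matrix.unitaryGroup (Fin n) ℂ) (x : LineBundleSoliton.X n m),
          f (LineBundleSoliton.rotate A x) = f x) →
        m = n ∧
        ∃ α β a : ℝ, 0 < β ∧ 0 < a ∧
          (∀ t, deriv u t ^ (n - 1) * deriv (deriv u) t * Real.exp (α * deriv u t) =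
            β * Real.exp (n * t)) ∧
          Filter.Tendsto (deriv u) Filter.atBot (nhds a)) := by
  have hn0 : n ≠ 0 := by omega
  refine ⟨fun a ha => ?_, fun m hm u g f hu hg hs hf => ?_⟩
  · obtain ⟨Φ, h⟩ := LineBundleSoliton.exists_isProfile hn0 ha
    have hd := h.deriv_potential_apply
    refine ⟨LineBundleSoliton.potential n Φ, LineBundleSoliton.solitonMetric h hn0,
      fun x => Φ (LineBundleSoliton.fibreNormSq x), h.contDiff_potential, fun t => ?_,
      h.soliton_equation hn0, h.tendsto_deriv_potential hn0,
      LineBundleSoliton.hasRadialPotential_solitonMetric h hn0,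
      LineBundleSoliton.rotationallySymmetric_solitonMetric h hn0,
      LineBundleSoliton.isSteadyGradientSoliton_solitonMetric h hn0, fun z hz => ?_,
      LineBundleSoliton.isComplete_solitonMetric h hn0,
      LineBundleSoliton.fibreCurvature_solitonMetric_pos h hn0⟩
    · have hn' : (0 : ℝ) < n := Nat.cast_pos.2 (Nat.pos_of_ne_zero hn0)
      rw [h.deriv_deriv_potential, hd]
      exact ⟨h.pos (Real.exp_pos _).le, mul_pos (mul_pos hn' (Real.exp_pos _))
        (h.deriv_pos hn0 (Real.exp_pos _).le)⟩
    · rw [hd, Real.exp_nat_mul, Real.exp_log (LineBundleSoliton.normSq_pos hz)]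
      exact congrArg Φ (LineBundleSoliton.fibreNormSq_cover z hz)
  · have hm0 : m ≠ 0 := by omega
    let j : Fin n := ⟨0, by omega⟩
    -- A second index exists because n ≥ 2; it supplies a direction tangent to the zero section.
    let k : Fin n := ⟨1, by omega⟩
    have hk : k ≠ j := by simp [k, j]
    -- The restriction of f to a real curve in one fibre is smooth in t, and by invariance it
    -- determines f off the zero section.
    let F : ℝ → ℝ := fun t => f (LineBundleSoliton.param j (LineBundleSoliton.fibrePoint m j t))
    have hF : ContDiff ℝ ∞ F := (hs j).1.comp (LineBundleSoliton.contDiff_fibrePoint j)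
    have hfF : ∀ p : Fin n → ℂ, p j ≠ 0 →
        f (LineBundleSoliton.param j p) = F (LineBundleSoliton.logCoord m j p) := fun p hp =>
      LineBundleSoliton.apply_param_eq_of_invariant hm0 hf j hp
    obtain ⟨α, c, hα⟩ := hg.exists_affine hu hm0 j hF hs hfF
    obtain ⟨d, hd⟩ := hg.exists_log_eq hu hm0 hk hF hs hfF
    obtain ⟨a, ha, hlim⟩ := hg.tendsto_deriv hu hm0 hk
    -- Inserting F = αφ + c into log(φ^{n-1}φ') + F = nt + d and exponentiating gives β = e^{d-c}.
    have hode : ∀ t, deriv u t ^ (n - 1) * deriv (deriv u) t * Real.exp (α * deriv u t) =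
        Real.exp (d - c) * Real.exp (n * t) := fun t => by
      have h1 := hd t
      have h2 : 0 < deriv u t ^ (n - 1) * deriv (deriv u) t :=
        mul_pos (pow_pos (hg.deriv_pos hu hm0 hk t) _) (hg.deriv_deriv_pos hu hm0 j t)
      rw [hα] at h1
      rw [← Real.exp_log h2, ← Real.exp_add, ← Real.exp_add]
      congr 1
      linarith
    exact ⟨hg.degree_eq hu hm0 j (Real.exp_pos _) ha hode hlim, α, Real.exp (d - c), a,
      Real.exp_pos _, ha, hode, hlim⟩
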